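/- Let $\gamma,\beta>0$ be real with $\gamma\neq 1$. Let $H^1_e(0,1)=\{f\in H^1(0,1): f(1)=0\}$ and let $\mathbb H=H^1_e(0,1)\times L^2(0,1)$ be the complex Hilbert space with norm $\|(f,g)\|^2_{\mathbb H}=\int_0^1\left(|f'(x)|^2+|g(x)|^2\right)dx$. Let $\mathbb A$ be the unbounded operator on $\mathbb H$ given by $\mathbb A(f,g)=(g,f'')$ with domain $$D(\mathbb A)=\{(f,g)\in (H^1_e(0,1)\cap H^2(0,1))\times H^1_e(0,1): f'(0)=\gamma g(0)+\beta f(0)\}.$$ For $n\in\mathbb Z$ put $n_\gamma=n-\tfrac12$ if $0<\gamma<1$ and $n_\gamma=n$ if $\gamma>1$. Then: (a) $\mathbb A$ is a discrete operator, i.e. for some $z\in\mathbb C$ the resolvent $(z-\mathbb A)^{-1}$ exists as a bounded operator on $\mathbb H$ and is compact. (b) There is a family $\{\lambda_n\}_{n\in\mathbb Z}$ of nonzero complex numbers (repetitions allowed) whose set of values is exactly the set of eigenvalues of $\mathbb A$, with $$\lambda_n=\tfrac12\ln\left|\frac{\gamma-1}{\gamma+1}\right|+n_\gamma\pi i+O(|n|^{-1})\qquad(|n|\to\infty).$$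 (c) For every $n$, with $f_n(x)=\sinh\lambda_n(x-1)$, the pair $(\lambda_n^{-1}f_n,f_n)$ is an eigenfunction of $\mathbb A$ for $\lambda_n$, and every eigenfunction for $\lambda_n$ is a scalar multiple of it. Moreover, uniformly in $x\in[0,1]$ and for $n\neq0$, the pair $F_n(x)=(\lambda_n^{-1}f_n'(x),f_n(x))$ satisfies $$F_n(x)=\tfrac12\left(e_n^+(x)+e_n^-(x),\; e_n^+(x)-e_n^-(x)\right)+O(|n|^{-1}),$$ where $e_n^+(x)=\left|\frac{\gamma-1}{\gamma+1}\right|^{(x-1)/2}e^{n_\gamma\pi i(x-1)}$ and $e_n^-(x)=\left|\frac{\gamma+1}{\gamma-1}\right|^{(x-1)/2}e^{-n_\gamma\pi i(x-1)}$. (d) There is a family $\{\Phi_n\}_{n\in\mathbb Z}$, where $\Phi_n$ is a generalized eigenfunction of $\mathbb A$ for the eigenvalue $\lambda_n$ (that is, $\Phi_n\ne0$ and $(\mathbb A-\lambda_n)^k\Phi_n=0$ for some $k\in\mathbb N$), which is a Riesz basis of $\mathbb H$, i.e. the image of an orthonormal basis of $\mathbb H$ under a bounded linear bijection of $\mathbb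 H$ with bounded inverse. -/

import Mathlib

open MeasureTheory Set Filter Asymptotics
open scoped unitInterval

noncomputable section

/-- The complex Hilbert space `L²(0,1)` (the end points of `I = [0,1]` are Lebesgue-null). -/
abbrev L2 : Type := Lp ℂ 2 (volume : Measure I)

/-- The class in `L²(0,1)` of a continuous function on `[0,1]`. -/
abbrev toL2 : C(I, ℂ) →L[ℂ] L2 := ContinuousMap.toLp 2 volume ℂ

lemma L2.integrable (v : L2) : Integrable v (volume : Measure I) :=
  (Lp.memLp v).integrable (by norm_num)

/-- The Sobolev space `H¹(0,1)`: the absolutely continuous functions `f` on `[0,1]` whose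
derivative belongs to `L²(0,1)`. An element is recorded as the pair `(f, f')`, where `f' ∈ L²(0,1)`
is the function with `f(x) = f(0) + ∫₀ˣ f'(t) dt` for all `x ∈ [0,1]`; it is determined by `f`
(see `H1.deriv_eq_zero`). -/
def H1 : Submodule ℂ (C(I, ℂ) × L2) where
  carrier := {p | ∀ x : I, p.1 x = p.1 0 + ∫ t in Iic x, p.2 t}
  zero_mem' := by
    intro x
    have h : ∫ t in Iic x, (0 : L2) t = 0 := by
      rw [integral_congr_ae (ae_restrict_of_ae (Lp.coeFn_zero ℂ 2 (volume : Measure I)))]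
      simp
    simp
  add_mem' := by
    intro p q hp hq x
    have h : ∫ t in Iic x, (p.2 + q.2) t = (∫ t in Iic x, p.2 t) + ∫ t in Iic x, q.2 t := by
      rw [← integral_add p.2.integrable.integrableOn q.2.integrable.integrableOn]
      exact integral_congr_ae (ae_restrict_of_ae (Lp.coeFn_add p.2 q.2))
    simp only [Prod.fst_add, Prod.snd_add, ContinuousMap.add_apply, h]
    rw [hp x, hq x]
    ring
  smul_mem' := by
    intro c p hp x
    have h : ∫ t in Iic x, (c • p.2) t = c * ∫ t in Iic x, p.2 t := by
      rw [← integral_const_mul]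
      exact integral_congr_ae (ae_restrict_of_ae (Lp.coeFn_smul c p.2))
    simp only [Prod.smul_fst, Prod.smul_snd, ContinuousMap.smul_apply, smul_eq_mul, h]
    rw [hp x]
    ring

instance isOpenPosMeasure_volume_unitInterval : (volume : Measure I).IsOpenPosMeasure := by
  refine ⟨fun U hU hne h => ?_⟩
  obtain ⟨a, b, hab, hs⟩ := hU.exists_Ioo_subset hne
  have h0 := measure_mono_null hs h
  rw [unitInterval.volume_Ioo, ENNReal.ofReal_eq_zero] at h0
  have : (a : ℝ) < b := hab
  linarith

lemma L2.eq_zero_of_integral_Iic (v : L2) (h : ∀ x : I, ∫ t in Iic x, v t = 0) : v = 0 := by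
  have key : ∀ s : Set I, MeasurableSet s → ∫ t in s, v t = 0 := by
    intro s hs
    induction s, hs using MeasurableSpace.induction_on_inter
      (borel_eq_generateFrom_Iic I ▸ BorelSpace.measurable_eq) isPiSystem_Iic with
    | empty => simp
    | basic t ht => obtain ⟨x, rfl⟩ := ht; exact h x
    | compl t ht ih =>
      have h1 := integral_add_compl ht v.integrable
      have h2 : ∫ t, v t = 0 := by
        have := h 1
        rwa [show Iic (1 : I) = univ from Set.eq_univ_of_forall fun x => unitInterval.le_one',
          setIntegral_univ] at this
      rw [ih, h2, zero_add] at h1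
      exact h1
    | iUnion f hd hm ih =>
      rw [integral_iUnion hm hd v.integrable.integrableOn]
      simp [ih]
  have := v.integrable.ae_eq_zero_of_forall_setIntegral_eq_zero fun s hs _ => key s hs
  exact (Lp.eq_zero_iff_ae_eq_zero).2 this

/-- The derivative of an `H¹` function is determined by (the class of) the function. -/
lemma H1.deriv_eq_zero {p : C(I, ℂ) × L2} (hp : p ∈ H1) (h : toL2 p.1 = 0) :
    p.1 = 0 ∧ p.2 = 0 := by
  have h1 : p.1 = 0 := ContinuousMap.toLp_injective (𝕜 := ℂ) (p := 2)
    (volume : Measure I) (h.trans (map_zero _).symm)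
  refine ⟨h1, L2.eq_zero_of_integral_Iic _ fun x => ?_⟩
  have := hp x
  rw [h1] at this
  simpa using this.symm

/-- `{f ∈ H¹(0,1) | f(1) = 0}` as a subspace of `H¹(0,1)`. -/
def H1eSubmodule : Submodule ℂ (C(I, ℂ) × L2) where
  carrier := {p | p ∈ H1 ∧ p.1 1 = 0}
  zero_mem' := ⟨H1.zero_mem, by simp⟩
  add_mem' := fun hp hq => ⟨H1.add_mem hp.1 hq.1, by simp [hp.2, hq.2]⟩
  smul_mem' := fun c p hp => ⟨H1.smul_mem c hp.1, by simp [hp.2]⟩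

/-- The space `H¹ₑ(0,1) = {f ∈ H¹(0,1) | f(1) = 0}`. It is a type of its own because it carries
the inner product `∫₀¹ f' \bar{h'}`, not the norm of the ambient product. -/
def H1e : Type := H1eSubmodule

namespace H1e

instance : AddCommGroup H1e := inferInstanceAs (AddCommGroup H1eSubmodule)

instance : Module ℂ H1e := inferInstanceAs (Module ℂ H1eSubmodule)

/-- The function `f`, continuous on `[0,1]`. -/
def fn : H1e →ₗ[ℂ] C(I, ℂ) := (LinearMap.fst ℂ _ _).comp H1eSubmodule.subtype

/-- The derivative `f' ∈ L²(0,1)`. -/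
def deriv : H1e →ₗ[ℂ] L2 := (LinearMap.snd ℂ _ _).comp H1eSubmodule.subtype

lemma fn_eq (f : H1e) (x : I) : f.fn x = f.fn 0 + ∫ t in Iic x, f.deriv t := f.2.1 x

lemma fn_one (f : H1e) : f.fn 1 = 0 := f.2.2

lemma mem_H1 (f : H1e) : (f.fn, f.deriv) ∈ H1 := f.2.1

lemma ext' {f h : H1e} (h₁ : f.fn = h.fn) (h₂ : f.deriv = h.deriv) : f = h :=
  Subtype.ext (Prod.ext h₁ h₂)

lemma eq_zero_of_deriv {f : H1e} (h : f.deriv = 0) : f = 0 := by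
  have hz : ∀ x : I, ∫ t in Iic x, f.deriv t = 0 := fun x => by
    rw [h, integral_congr_ae (ae_restrict_of_ae (Lp.coeFn_zero ℂ 2 (volume : Measure I)))]
    simp
  have hc : ∀ x : I, f.fn x = f.fn 0 := fun x => by rw [f.fn_eq x, hz x, add_zero]
  refine ext' (ContinuousMap.ext fun x => ?_) (h.trans (map_zero _).symm)
  rw [hc x, ← hc 1, f.fn_one, map_zero]
  rfl

/-- The inner product of `H¹ₑ(0,1)` is the `L²` inner product of the derivatives
(conjugate-linear in the first argument). -/
@[reducible] def core : InnerProductSpace.Core ℂ H1e where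
  inner f h := inner ℂ f.deriv h.deriv
  conj_inner_symm f h := inner_conj_symm _ _
  re_inner_nonneg f := inner_self_nonneg
  add_left f h k := by rw [map_add, inner_add_left]
  smul_left f h c := by rw [map_smul, inner_smul_left]
  definite f hf := eq_zero_of_deriv (inner_self_eq_zero.1 hf)

instance : NormedAddCommGroup H1e := core.toNormedAddCommGroup

instance : InnerProductSpace ℂ H1e := InnerProductSpace.ofCore core.toCore

lemma inner_eq (f h : H1e) : inner ℂ f h = inner ℂ f.deriv h.deriv := rfl

end H1e

/-- The state space `H¹ₑ(0,1) × L²(0,1)` with `‖(f,g)‖² = ∫₀¹ (|f'|² + |g|²)`. -/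
abbrev StateSpace : Type := WithLp 2 (H1e × L2)

lemma StateSpace.norm_sq_eq (X : StateSpace) :
    ‖X‖ ^ 2 = ‖X.fst.deriv‖ ^ 2 + ‖X.snd‖ ^ 2 := by
  rw [WithLp.prod_norm_sq_eq_of_L2]
  congr 2
  exact (norm_eq_sqrt_re_inner (𝕜 := ℂ) X.fst).trans
    (norm_eq_sqrt_re_inner (𝕜 := ℂ) X.fst.deriv).symm

/-- The graph of the wave operator: the pairs `((f,g), (g,f''))` with `f ∈ H¹ₑ ∩ H²`, `g ∈ H¹ₑ`
and `f'(0) = γ g(0) + β f(0)`. Here the pair `p` is `(f', f'')`; that it lies in `H¹` means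
`f ∈ H²(0,1)`. -/
def waveGraph (γ β : ℝ) : Submodule ℂ (StateSpace × StateSpace) where
  carrier := {Z | toL2 Z.2.fst.fn = Z.1.snd ∧
    ∃ p ∈ H1, toL2 p.1 = Z.1.fst.deriv ∧ p.2 = Z.2.snd ∧
      p.1 0 = γ * Z.2.fst.fn 0 + β * Z.1.fst.fn 0}
  zero_mem' := ⟨by simp, 0, H1.zero_mem, by simp, by simp, by simp⟩
  add_mem' := by
    rintro Z W ⟨hZ, p, hp, h1, h2, h3⟩ ⟨hW, q, hq, k1, k2, k3⟩
    refine ⟨by simp [hZ, hW], p + q, H1.add_mem hp hq, by simp [h1, k1], by simp [h2, k2], ?_⟩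
    simp only [Prod.fst_add, ContinuousMap.add_apply, h3, k3, Prod.snd_add, WithLp.add_fst,
      map_add]
    ring
  smul_mem' := by
    rintro c Z ⟨hZ, p, hp, h1, h2, h3⟩
    refine ⟨by simp [hZ], c • p, H1.smul_mem c hp, by simp [h1], by simp [h2], ?_⟩
    simp only [Prod.smul_fst, ContinuousMap.smul_apply, h3, Prod.smul_snd, WithLp.smul_fst,
      map_smul, smul_eq_mul]
    ring

lemma waveGraph_functional (γ β : ℝ) (Z : StateSpace × StateSpace) (hZ : Z ∈ waveGraph γ β)
    (h : Z.1 = 0) : Z.2 = 0 := by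
  obtain ⟨hg, p, hp, h1, h2, -⟩ := hZ
  rw [h] at hg h1
  obtain ⟨a, b⟩ := H1.deriv_eq_zero Z.2.fst.mem_H1 hg
  have c : p.2 = 0 := (H1.deriv_eq_zero hp (by rw [h1]; simp)).2
  have d : Z.2.fst = 0 := H1e.ext' (a.trans (map_zero _).symm) (b.trans (map_zero _).symm)
  have e : Z.2.snd = 0 := h2 ▸ c
  exact (WithLp.ofLp_injective 2) (Prod.ext d e)

/-- The unbounded operator `𝔸 (f, g) = (g, f'')` on `H¹ₑ(0,1) × L²(0,1)` with domain
`{(f,g) ∈ (H¹ₑ ∩ H²) × H¹ₑ | f'(0) = γ g(0) + β f(0)}`. -/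
def waveOperator (γ β : ℝ) : StateSpace →ₗ.[ℂ] StateSpace := (waveGraph γ β).toLinearPMap

lemma waveOperator_graph (γ β : ℝ) : (waveOperator γ β).graph = waveGraph γ β :=
  (waveGraph γ β).toLinearPMap_graph_eq (waveGraph_functional γ β)

section Operators

variable {H : Type*} [NormedAddCommGroup H] [InnerProductSpace ℂ H]

/-- The bounded operator `R` is the resolvent `(z - A)⁻¹` of the unbounded operator `A`. -/
def IsResolventAt (A : H →ₗ.[ℂ] H) (z : ℂ) (R : H →L[ℂ] H) : Prop :=
  (∀ y : H, ∃ h : R y ∈ A.domain, z • R y - A ⟨R y, h⟩ = y) ∧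
    ∀ x : A.domain, R (z • (x : H) - A x) = x

/-- A discrete operator: some resolvent `(z - A)⁻¹` exists as a bounded operator on the whole
space and is compact. -/
def IsDiscreteOperator (A : H →ₗ.[ℂ] H) : Prop :=
  ∃ (z : ℂ) (R : H →L[ℂ] H), IsResolventAt A z R ∧ IsCompactOperator R

/-- `x` is an eigenvector of the unbounded operator `A` for the eigenvalue `z`. -/
def IsEigenvector (A : H →ₗ.[ℂ] H) (z : ℂ) (x : H) : Prop :=
  x ≠ 0 ∧ ∃ h : x ∈ A.domain, A ⟨x, h⟩ = z • x

/-- `z` is an eigenvalue of the unbounded operator `A`. -/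
def IsEigenvalue (A : H →ₗ.[ℂ] H) (z : ℂ) : Prop := ∃ x, IsEigenvector A z x

/-- `(A - z)ᵏ x` is defined and vanishes. -/
def PowKills (A : H →ₗ.[ℂ] H) (z : ℂ) : ℕ → H → Prop
  | 0, x => x = 0
  | k + 1, x => ∃ h : x ∈ A.domain, PowKills A z k (A ⟨x, h⟩ - z • x)

/-- `x` is a generalized eigenvector (root vector) of `A` for the eigenvalue `z`. -/
def IsGeneralizedEigenvector (A : H →ₗ.[ℂ] H) (z : ℂ) (x : H) : Prop :=
  x ≠ 0 ∧ ∃ k : ℕ, PowKills A z k x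

/-- A Riesz basis: the image of an orthonormal (Hilbert) basis under a bounded linear operator
with bounded inverse. -/
def IsRieszBasis {ι : Type*} (Φ : ι → H) : Prop :=
  ∃ (b : HilbertBasis ι ℂ H) (T : H ≃L[ℂ] H), ∀ i, T (b i) = Φ i

end Operators

/-- The index shift: `n - 1/2` if `γ < 1` and `n` if `γ > 1`. -/
def nShift (γ : ℝ) (n : ℤ) : ℝ := if γ < 1 then (n : ℝ) - 1 / 2 else (n : ℝ)

/-- The function `x ↦ sinh (z (x - 1))`. -/
def sinhFn (z : ℂ) (x : ℝ) : ℂ := Complex.sinh (z * (x - 1))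

/-- The leading exponential `|(γ-1)/(γ+1)|^((x-1)/2) e^{i n_γ π (x-1)}`. -/
def leadPlus (γ : ℝ) (n : ℤ) (x : ℝ) : ℂ :=
  ((|(γ - 1) / (γ + 1)| ^ ((x - 1) / 2) : ℝ) : ℂ) *
    Complex.exp (nShift γ n * Real.pi * Complex.I * (x - 1))

/-- The leading exponential `|(γ+1)/(γ-1)|^((x-1)/2) e^{-i n_γ π (x-1)}`. -/
def leadMinus (γ : ℝ) (n : ℤ) (x : ℝ) : ℂ :=
  ((|(γ + 1) / (γ - 1)| ^ ((x - 1) / 2) : ℝ) : ℂ) *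
    Complex.exp (-(nShift γ n * Real.pi * Complex.I * (x - 1)))

end

/-! The operator has an explicit compact inverse `waveInv`, so every spectral question is moved to a
bounded operator `R`. Solving `f'' = z² f` with `f(1) = 0` leaves one candidate eigenvector for each
`z`, namely `expState z`, and the boundary condition becomes `z cosh z + (γ z + β) sinh z = 0`.

For large `z` this is close to `cosh z + γ sinh z = 0`, whose roots are exactly the leading
exponents `leadExp γ n`. They have a common real part and their imaginary parts are spaced by `π`.
Hence the states `expState (leadExp γ n)` are the image of an orthonormal trigonometric basis under
a single automorphism, multiplication by a hyperbolic rotation matrix, and so they form a Riesz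
basis. The inverse function theorem in the variable `1 / leadExp γ n` yields true roots at distance
`O(1/|n|)` (`exists_isCharRoot`), and the corresponding eigenvectors are quadratically close to that
Riesz basis.

Quadratic closeness gives a Riesz basis only after finitely many vectors are exchanged. The exchange
is linear algebra (`HilbertBasis.exists_root_vectors`): `R` is block triangular, with a diagonal
part and a finite-dimensional compression, and a basis of root vectors of the compression lifts to
root vectors of `R`. Dense range of `R` keeps zero out of the spectrum of the compression. The block
form also shows that the listed eigenvalues are all of them, so no roots need to be counted by
contour integrals, and the indexing by `ℤ` is inherited from the orthonormal basis. -/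

section RieszPerturbation

/-! ### Perturbation of Riesz bases by square-summable deviations. -/

variable {ι H : Type*} [NormedAddCommGroup H] [InnerProductSpace ℂ H]

/-- A square-summable family of vectors defines a bounded operator sending a Hilbert basis to it. -/
lemma HilbertBasis.exists_clm_of_summable [CompleteSpace H] (b : HilbertBasis ι ℂ H) (G : ι → H)
    (hG : Summable fun n => ‖G n‖ ^ 2) :
    ∃ K : H →L[ℂ] H, (∀ n, K (b n) = G n) ∧ ‖K‖ ≤ √(∑' n, ‖G n‖ ^ 2) := by
  classical
  have hb : ∀ x : H, HasSum (fun n => ‖b.repr x n‖ ^ 2) (‖x‖ ^ 2) := by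
    intro x
    have := lp.hasSum_norm (p := 2) (by norm_num) (b.repr x)
    rw [b.repr.norm_map] at this
    simpa using this
  have hs : ∀ x : H, Summable fun n => ‖b.repr x n‖ * ‖G n‖ := fun x => by
    refine Summable.of_nonneg_of_le (fun n => by positivity) (fun n => ?_)
      ((hb x).summable.add hG)
    nlinarith [sq_nonneg (‖b.repr x n‖ - ‖G n‖), sq_nonneg (‖b.repr x n‖), sq_nonneg (‖G n‖)]
  have hs' : ∀ x : H, Summable fun n => b.repr x n • G n := fun x =>
    Summable.of_norm (by simpa only [norm_smul] using hs x)
  let K : H →ₗ[ℂ] H :=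
    { toFun := fun x => ∑' n, b.repr x n • G n
      map_add' := fun x y => by
        rw [← (hs' x).tsum_add (hs' y)]
        simp [add_smul]
      map_smul' := fun c x => by
        simp only [RingHom.id_apply]
        rw [← (hs' x).tsum_const_smul c]
        simp [mul_smul] }
  have hK : ∀ x, ‖K x‖ ≤ √(∑' n, ‖G n‖ ^ 2) * ‖x‖ := by
    intro x
    have h1 : ‖K x‖ ≤ ∑' n, ‖b.repr x n‖ * ‖G n‖ := by
      refine (norm_tsum_le_tsum_norm (by simpa only [norm_smul] using hs x)).trans ?_
      simp only [norm_smul]; exact le_rfl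
    have h2 := Real.inner_le_Lp_mul_Lq_tsum_of_nonneg (p := 2) (q := 2)
      Real.HolderConjugate.two_two (f := fun n => ‖b.repr x n‖) (g := fun n => ‖G n‖)
      (fun n => norm_nonneg _) (fun n => norm_nonneg _)
      (by simpa using (hb x).summable) (by simpa using hG)
    have h3 : ∑' n, ‖b.repr x n‖ ^ 2 = ‖x‖ ^ 2 := (hb x).tsum_eq
    simp only [Real.rpow_two, h3, ← Real.sqrt_eq_rpow] at h2
    rw [Real.sqrt_sq (norm_nonneg x), mul_comm] at h2
    exact h1.trans h2
  refine ⟨K.mkContinuous _ hK, fun n => ?_, K.mkContinuous_norm_le (Real.sqrt_nonneg _) hK⟩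
  change ∑' m, b.repr (b n) m • G m = G n
  rw [tsum_eq_single n]
  · simp [b.repr_self]
  · intro m hm
    rw [b.repr_self, lp.single_apply_ne _ _ _ hm, zero_smul]

/-- A family quadratically close to a Riesz basis agrees with some Riesz basis up to finitely many
indices. -/
lemma HilbertBasis.exists_equiv_of_summable [CompleteSpace H] (b : HilbertBasis ι ℂ H)
    (S : H ≃L[ℂ] H) (F : ι → H) (hF : Summable fun n => ‖F n - S (b n)‖ ^ 2) (J₀ : Finset ι) :
    ∃ J : Finset ι, J₀ ⊆ J ∧ ∃ T : H ≃L[ℂ] H, ∀ n ∉ J, T (b n) = F n := by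
  classical
  set G : ι → H := fun n => S.symm (F n) - b n with hGdef
  have hG : Summable fun n => ‖G n‖ ^ 2 := by
    refine Summable.of_nonneg_of_le (fun n => by positivity) (fun n => ?_)
      (hF.mul_left (‖(S.symm : H →L[ℂ] H)‖ ^ 2))
    have : G n = S.symm (F n - S (b n)) := by simp [hGdef]
    rw [this, ← mul_pow]
    exact pow_le_pow_left₀ (norm_nonneg _) ((S.symm : H →L[ℂ] H).le_opNorm _) 2
  -- Outside a large finite `J` the deviations have total square below 1. Setting them to zero on
  -- `J` gives an operator `K` of norm below 1, and `1 + K` is invertible by the Neumann series.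
  obtain ⟨J, hJ₀, hJ⟩ : ∃ J : Finset ι, J₀ ⊆ J ∧
      ∑' n : { n // n ∉ J }, ‖G n‖ ^ 2 < 1 := by
    have h := (tendsto_tsum_compl_atTop_zero fun n => ‖G n‖ ^ 2).eventually
      (gt_mem_nhds (zero_lt_one' ℝ))
    exact ((eventually_ge_atTop J₀).and h).exists
  set G' : ι → H := fun n => if n ∈ J then 0 else G n with hG'def
  have hG'2 : (fun n => ‖G' n‖ ^ 2) = Set.indicator {n | n ∉ J} fun n => ‖G n‖ ^ 2 := by
    ext n
    by_cases hn : n ∈ J <;> simp [hG'def, hn]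
  have hG' : Summable fun n => ‖G' n‖ ^ 2 := hG'2 ▸ hG.indicator _
  obtain ⟨K, hK, hKn⟩ := b.exists_clm_of_summable G' hG'
  have hlt : ‖-K‖ < 1 := by
    rw [norm_neg]
    refine hKn.trans_lt ?_
    rw [Real.sqrt_lt' one_pos, one_pow, hG'2, ← tsum_subtype]
    exact hJ
  refine ⟨J, hJ₀, (ContinuousLinearEquiv.unitsEquiv ℂ H (Units.oneSub (-K) hlt)).trans S, ?_⟩
  intro n hn
  have : (ContinuousLinearEquiv.unitsEquiv ℂ H (Units.oneSub (-K) hlt)) (b n) = b n + K (b n) := by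
    simp [ContinuousLinearEquiv.unitsEquiv_apply]
  rw [ContinuousLinearEquiv.trans_apply, this, hK]
  simp [hG'def, hn, hGdef]

end RieszPerturbation

/-! ### Completing a nearly diagonal operator to a Riesz basis of root vectors. -/

section RootVectors

variable {ι H : Type*} [NormedAddCommGroup H] [InnerProductSpace ℂ H]

lemma HilbertBasis.ext_repr (b : HilbertBasis ι ℂ H) {x y : H}
    (h : ∀ n, b.repr x n = b.repr y n) : x = y :=
  b.repr.injective (lp.ext (funext h))

lemma HilbertBasis.repr_sub_smul_one_apply (b : HilbertBasis ι ℂ H) (R : H →L[ℂ] H) (z : ℂ)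
    (x : H) (n : ι) :
    b.repr ((R - z • (1 : H →L[ℂ] H)) x) n = b.repr (R x) n - z * b.repr x n := by
  change b.repr (R x - z • x) n = _
  rw [map_sub, map_smul]
  rfl

/-- Coordinates of the image of a vector without components along `b j`, `j ∈ J`, under an operator
that is diagonal off `J`. -/
lemma HilbertBasis.repr_diagonal_apply (b : HilbertBasis ι ℂ H) {R : H →L[ℂ] H} {μ : ι → ℂ}
    {J : Finset ι} (hR : ∀ n ∉ J, R (b n) = μ n • b n) {x : H} (hx : ∀ j ∈ J, b.repr x j = 0)
    (m : ι) : b.repr (R x) m = μ m * b.repr x m := by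
  classical
  have h1 : HasSum (fun n => b.repr x n • R (b n)) (R x) := by
    simpa using R.hasSum (b.hasSum_repr x)
  have h2 : HasSum (fun n => inner ℂ (b m) (b.repr x n • R (b n))) (inner ℂ (b m) (R x)) :=
    (innerSL ℂ (b m)).hasSum h1
  rw [b.repr_apply_apply, ← h2.tsum_eq, tsum_eq_single m]
  · by_cases hm : m ∈ J
    · simp [hx m hm]
    · have := (orthonormal_iff_ite.1 b.orthonormal) m m
      simp only [if_true] at this
      rw [hR m hm, inner_smul_right, inner_smul_right, this]
      ring
  · intro n hn
    by_cases hnJ : n ∈ J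
    · simp [hx n hnJ]
    · have := (orthonormal_iff_ite.1 b.orthonormal) m n
      rw [if_neg hn.symm] at this
      rw [hR n hnJ, inner_smul_right, inner_smul_right, this]
      simp

/-- Solvability of `(R - z) v = w` among the vectors on which `R` acts diagonally. -/
lemma HilbertBasis.exists_sub_smul_eq (b : HilbertBasis ι ℂ H) {R : H →L[ℂ] H} {μ : ι → ℂ}
    {J : Finset ι} (hR : ∀ n ∉ J, R (b n) = μ n • b n) (hμ : Tendsto μ cofinite (nhds 0))
    {z : ℂ} (hz : z ≠ 0) {w : H} (hw : ∀ j ∈ J, b.repr w j = 0)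
    (hwz : ∀ n, μ n = z → b.repr w n = 0) :
    ∃ v : H, (∀ j ∈ J, b.repr v j = 0) ∧ (∀ n, μ n = z → b.repr v n = 0) ∧
      (R - z • (1 : H →L[ℂ] H)) v = w := by
  -- Since `μ n → 0 ≠ z`, the factors `(μ n - z)⁻¹` are bounded. At the indices with `μ n = z` the
  -- inverse is `0` by convention, and there `w` has no component.
  have hlim : Tendsto (fun n => ‖(μ n - z)⁻¹‖) cofinite (nhds ‖((0 : ℂ) - z)⁻¹‖) :=
    ((hμ.sub_const z).inv₀ (by simpa using hz)).norm
  obtain ⟨C, hC⟩ := hlim.bddAbove_range_of_cofinite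
  have hC' : ∀ n, ‖(μ n - z)⁻¹‖ ≤ C := fun n => hC ⟨n, rfl⟩
  have hmem : Memℓp (fun n => (μ n - z)⁻¹ * b.repr w n) 2 := by
    refine memℓp_gen ?_
    have hs : Summable fun n => ‖b.repr w n‖ ^ 2 := by
      simpa using (lp.hasSum_norm (p := 2) (by norm_num) (b.repr w)).summable
    refine Summable.of_nonneg_of_le (fun n => by positivity) (fun n => ?_) (hs.mul_left (C ^ 2))
    simp only [ENNReal.toReal_ofNat, Real.rpow_two, norm_mul, mul_pow]
    gcongr
    exact hC' n
  set v : H := b.repr.symm ⟨_, hmem⟩ with hv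
  have hvn : ∀ n, b.repr v n = (μ n - z)⁻¹ * b.repr w n := fun n => by
    rw [hv, LinearIsometryEquiv.apply_symm_apply]
  have hvJ : ∀ j ∈ J, b.repr v j = 0 := fun j hj => by rw [hvn, hw j hj, mul_zero]
  refine ⟨v, hvJ, fun n hn => by rw [hvn, hwz n hn, mul_zero], b.ext_repr fun n => ?_⟩
  have : b.repr ((R - z • (1 : H →L[ℂ] H)) v) n = (μ n - z) * b.repr v n := by
    rw [b.repr_sub_smul_one_apply, b.repr_diagonal_apply hR hvJ n]
    ring
  rw [this, hvn]
  by_cases hn : μ n = z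
  · rw [hwz n hn]; simp
  · rw [mul_inv_cancel_left₀ (sub_ne_zero.2 hn)]

/-- The single solve can be iterated because its solution satisfies the same vanishing conditions as
its right-hand side; this is why they reappear in the conclusion. -/
lemma HilbertBasis.exists_pow_sub_smul_eq (b : HilbertBasis ι ℂ H) {R : H →L[ℂ] H} {μ : ι → ℂ}
    {J : Finset ι} (hR : ∀ n ∉ J, R (b n) = μ n • b n) (hμ : Tendsto μ cofinite (nhds 0))
    {z : ℂ} (hz : z ≠ 0) (k : ℕ) {w : H} (hw : ∀ j ∈ J, b.repr w j = 0)
    (hwz : ∀ n, μ n = z → b.repr w n = 0) :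
    ∃ v : H, (∀ j ∈ J, b.repr v j = 0) ∧ (∀ n, μ n = z → b.repr v n = 0) ∧
      ((R - z • (1 : H →L[ℂ] H)) ^ k) v = w := by
  induction k with
  | zero => exact ⟨w, hw, hwz, by simp⟩
  | succ k ih =>
    obtain ⟨v, hvJ, hvz, hv⟩ := ih
    obtain ⟨u, huJ, huz, hu⟩ := b.exists_sub_smul_eq hR hμ hz hvJ hvz
    exact ⟨u, huJ, huz, by rw [pow_succ, mul_apply_eq_comp, hu, hv]⟩

/-- A basis of root vectors of an endomorphism, indexed by any given type of the right size, whose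
eigenvalues exhaust all eigenvalues. -/
lemma Module.End.exists_basis_mem_maxGenEigenspace {κ E : Type*} [Fintype κ] [AddCommGroup E]
    [Module ℂ E] (B₀ : Module.Basis κ ℂ E) (f : Module.End ℂ E) :
    ∃ (B : Module.Basis κ ℂ E) (ν : κ → ℂ), (∀ j, B j ∈ f.maxGenEigenspace (ν j)) ∧
      ∀ z x, x ≠ 0 → f x = z • x → ∃ j, ν j = z := by
  have : FiniteDimensional ℂ E := Module.Basis.finiteDimensional_of_finite B₀
  have hspan : ⊤ ≤ Submodule.span ℂ (⋃ z, (f.maxGenEigenspace z : Set E)) := by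
    rw [Submodule.span_iUnion]
    simp only [Submodule.span_eq]
    rw [Module.End.iSup_maxGenEigenspace_eq_top]
  let B₁ := Module.Basis.ofSpan hspan
  let B := B₁.reindex (B₁.indexEquiv B₀)
  have hB : ∀ j, ∃ z, B j ∈ f.maxGenEigenspace z := fun j => by
    have : B j ∈ ⋃ z, (f.maxGenEigenspace z : Set E) :=
      Module.Basis.ofSpan_subset hspan ⟨_, (B₁.reindex_apply _ _).symm⟩
    exact mem_iUnion.1 this
  choose ν hν using hB
  refine ⟨B, ν, hν, fun z x hx hfx => ?_⟩
  by_contra! hne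
  -- If `z` were not among the `ν j`, the generalized eigenspaces of the other values would already
  -- span the space, and independence would make the one at `z` trivial.
  have htop : (⨆ (y) (_ : y ≠ z), f.maxGenEigenspace y) = ⊤ := by
    rw [eq_top_iff, ← B.span_eq, Submodule.span_le]
    rintro _ ⟨j, rfl⟩
    exact (le_iSup₂_of_le (f := fun y (_ : y ≠ z) => f.maxGenEigenspace y) (ν j) (hne j) le_rfl)
      (hν j)
  have hd := f.independent_maxGenEigenspace z
  rw [htop, disjoint_top] at hd
  have : x ∈ f.maxGenEigenspace z :=
    f.mem_maxGenEigenspace z x |>.2 ⟨1, by simp [hfx]⟩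
  rw [hd] at this
  exact hx this

/-- The vectors without coordinates in `J` form an invariant subspace on which `R` is diagonal, so
`R` is block triangular; the other block is the compression `Q` to the coordinates in `J`. Root
vectors of `Q` lift to root vectors of `R` after a correction in the diagonal part. An eigenvector
of `R` either lies in the diagonal part, where its eigenvalue is some `μ n`, or projects to an
eigenvector of `Q`. -/
theorem HilbertBasis.exists_root_vectors [CompleteSpace H] (b : HilbertBasis ι ℂ H)
    {R : H →L[ℂ] H} (hRd : DenseRange R) {μ : ι → ℂ} {J : Finset ι}
    (hR : ∀ n ∉ J, R (b n) = μ n • b n) (hμ : Tendsto μ cofinite (nhds 0))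
    (hμ0 : ∀ n ∉ J, μ n ≠ 0) :
    ∃ (ν : ι → ℂ) (Φ : ι → H) (T : H ≃L[ℂ] H), (∀ n ∉ J, ν n = μ n ∧ Φ n = b n) ∧
      (∀ n, ν n ≠ 0) ∧ (∀ n, ∃ k : ℕ, ((R - ν n • (1 : H →L[ℂ] H)) ^ k) (Φ n) = 0) ∧
      (∀ n, T (b n) = Φ n) ∧ ∀ z x, x ≠ 0 → R x = z • x → ∃ n, ν n = z := by
  classical
  let inc : (J → ℂ) →ₗ[ℂ] H := Fintype.linearCombination ℂ fun j : J => b j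
  have hinc : ∀ e, inc e = ∑ j, e j • b j := fun e => Fintype.linearCombination_apply _ _ _
  let π : H →L[ℂ] (J → ℂ) := ContinuousLinearMap.pi fun j => innerSL ℂ (b j)
  have hπ : ∀ x j, π x j = b.repr x j := fun x j => (b.repr_apply_apply x j).symm
  have hπ0 : ∀ x, π x = 0 ↔ ∀ j ∈ J, b.repr x j = 0 := fun x =>
    ⟨fun h j hj => by rw [← hπ x ⟨j, hj⟩, h]; rfl,
      fun h => funext fun j => by rw [hπ, h j j.2]; rfl⟩
  have hπb : ∀ j : J, π (b j) = Pi.single j 1 := fun j => by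
    ext i
    rw [hπ, b.repr_self, lp.single_apply]
    by_cases h : i = j
    · rw [h, Pi.single_eq_same, Pi.single_eq_same]
    · rw [Pi.single_eq_of_ne h, Pi.single_eq_of_ne (fun h' => h (Subtype.ext h'))]
  have hπinc : ∀ e, π (inc e) = e := fun e => by
    rw [hinc, map_sum]
    simp only [map_smul, hπb]
    ext i
    simp [Finset.sum_apply, Pi.single_apply]
  let Q : Module.End ℂ (J → ℂ) := π.toLinearMap ∘ₗ R.toLinearMap ∘ₗ inc
  have hQ : ∀ e, Q e = π (R (inc e)) := fun e => rfl
  have hπR0 : ∀ x, π x = 0 → π (R x) = 0 := fun x hx => by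
    rw [hπ0] at hx ⊢
    intro j hj
    rw [b.repr_diagonal_apply hR hx, hx j hj, mul_zero]
  have hπR : ∀ x, π (R x) = Q (π x) := fun x => by
    have := hπR0 (x - inc (π x)) (by rw [map_sub, hπinc, sub_self])
    rw [map_sub, map_sub, sub_eq_zero] at this
    rw [this, hQ]
  have hπpow : ∀ (z : ℂ) (k : ℕ) (x : H), π (((R - z • (1 : H →L[ℂ] H)) ^ k) x) =
      ((Q - z • (1 : Module.End ℂ (J → ℂ))) ^ k) (π x) := by
    intro z k
    induction k with
    | zero => intro x; simp
    | succ k ih =>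
      intro x
      rw [pow_succ, mul_apply_eq_comp, ih, pow_succ, Module.End.mul_apply]
      simp [hπR]
  -- The range of `Q` contains the dense image of `π ∘ R` and is closed by finite dimension. This is
  -- the only use of the dense range; it excludes the eigenvalue `0` of `Q`.
  have hQsurj : Function.Surjective Q := by
    have hπs : Function.Surjective π := fun e => ⟨inc e, hπinc e⟩
    have hd : DenseRange (π ∘ R) := hπs.denseRange.comp hRd π.continuous
    rw [← LinearMap.range_eq_top]
    have hcl : IsClosed (LinearMap.range Q : Set (J → ℂ)) := Submodule.closed_of_finiteDimensional _
    rw [SetLike.ext'_iff, Submodule.top_coe, ← hcl.closure_eq, ← dense_iff_closure_eq]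
    refine hd.mono ?_
    rintro _ ⟨x, rfl⟩
    exact ⟨π x, (hπR x).symm⟩
  have hQinj : Function.Injective Q := LinearMap.injective_iff_surjective.2 hQsurj
  obtain ⟨B, ν₀, hB, hall⟩ := Module.End.exists_basis_mem_maxGenEigenspace (Pi.basisFun ℂ J) Q
  have hν₀ : ∀ j, ν₀ j ≠ 0 := fun j h0 => by
    obtain ⟨k, hk⟩ := (Q.mem_maxGenEigenspace _ _).1 (hB j)
    rw [h0, zero_smul, sub_zero] at hk
    have : Function.Injective (Q ^ k) := by
      rw [Module.End.coe_pow]; exact hQinj.iterate k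
    exact B.ne_zero j (this (hk.trans (map_zero _).symm))
  have hlift : ∀ j, ∃ x, π x = B j ∧ ∃ k : ℕ, ((R - ν₀ j • (1 : H →L[ℂ] H)) ^ k) x = 0 := by
    intro j
    obtain ⟨k, hk⟩ := (Q.mem_maxGenEigenspace _ _).1 (hB j)
    set A := R - ν₀ j • (1 : H →L[ℂ] H) with hA
    have h1 : π ((A ^ k) (inc (B j))) = 0 := by rw [hA, hπpow, hπinc, hk]
    set w := (A ^ k) (inc (B j)) with hw
    have h2 : π (A w) = 0 := by
      have := hπpow (ν₀ j) 1 w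
      rw [pow_one, pow_one, h1, map_zero] at this
      exact this
    -- The vector `w` lies in the diagonal part but may have components at indices with `μ n = ν₀
    -- j`. One more application of `A` removes them, so that `A w = A ^ (k + 1) v` becomes solvable;
    -- the lift is then `inc (B j) - v`.
    have h3 : ∀ n, μ n = ν₀ j → b.repr (A w) n = 0 := fun n hn => by
      have := b.repr_diagonal_apply hR ((hπ0 w).1 h1) n
      rw [hA, b.repr_sub_smul_one_apply, this, hn, sub_self]
    obtain ⟨v, hvJ, -, hv⟩ :=
      b.exists_pow_sub_smul_eq hR hμ (hν₀ j) (k + 1) ((hπ0 _).1 h2) h3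
    refine ⟨inc (B j) - v, by rw [map_sub, hπinc, (hπ0 v).2 hvJ, sub_zero], k + 1, ?_⟩
    rw [map_sub, hv, pow_succ', mul_apply_eq_comp, sub_self]
  choose x hxπ hxk using hlift
  have hX : ∃ Φ : ι → H, (∀ n ∉ J, Φ n = b n) ∧ ∀ j : J, Φ j = x j :=
    ⟨fun n => if h : n ∈ J then x ⟨n, h⟩ else b n, fun n hn => by simp [hn], fun j => by simp⟩
  have hN : ∃ ν : ι → ℂ, (∀ n ∉ J, ν n = μ n) ∧ ∀ j : J, ν j = ν₀ j :=
    ⟨fun n => if h : n ∈ J then ν₀ ⟨n, h⟩ else μ n, fun n hn => by simp [hn], fun j => by simp⟩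
  obtain ⟨Φ, hΦb, hΦx⟩ := hX
  obtain ⟨ν, hνμ, hνν₀⟩ := hN
  let X : (J → ℂ) →L[ℂ] H := LinearMap.toContinuousLinearMap (Fintype.linearCombination ℂ x)
  let incL : (J → ℂ) →L[ℂ] H := LinearMap.toContinuousLinearMap inc
  have hXa : ∀ e, X e = ∑ j, e j • x j := fun e => Fintype.linearCombination_apply _ _ _
  have hπX : ∀ e, π (X e) = ∑ j, e j • B j := fun e => by rw [hXa, map_sum]; simp [hxπ]
  -- `T₀` fixes the vectors without coordinates in `J` and sends `b j` to `x j`. It is block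
  -- triangular: the identity on the diagonal part, and the invertible change of basis to `B` on the
  -- coordinates in `J`.
  let T₀ : H →L[ℂ] H := 1 - incL ∘L π + X ∘L π
  have hT₀ : ∀ y, T₀ y = y - inc (π y) + X (π y) := fun y => rfl
  have hπT₀ : ∀ y, π (T₀ y) = ∑ j, π y j • B j := fun y => by
    rw [hT₀, map_add, map_sub, hπinc, sub_self, zero_add, hπX]
  have hinj : Function.Injective T₀ := by
    rw [injective_iff_map_eq_zero]
    intro y hy
    have h1 : ∑ j, π y j • B j = 0 := by rw [← hπT₀, hy, map_zero]
    have h2 : π y = 0 := funext (Fintype.linearIndependent_iff.1 B.linearIndependent _ h1)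
    simpa [hT₀, h2] using hy
  have hsurj : Function.Surjective T₀ := by
    intro y
    set c : J → ℂ := fun j => B.repr (π y) j with hc
    have hcy : π (X c) = π y := by rw [hπX]; exact B.sum_repr (π y)
    have h1 : π (inc c + (y - X c)) = c := by rw [map_add, map_sub, hπinc, hcy, sub_self, add_zero]
    refine ⟨inc c + (y - X c), ?_⟩
    rw [hT₀, h1]
    abel
  refine ⟨ν, Φ, ContinuousLinearEquiv.ofBijective T₀ (LinearMap.ker_eq_bot.2 hinj)
    (LinearMap.range_eq_top.2 hsurj), fun n hn => ⟨hνμ n hn, hΦb n hn⟩, fun n => ?_, fun n => ?_,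
    fun n => ?_, fun z y hy hyz => ?_⟩
  · by_cases hn : n ∈ J
    · exact (hνν₀ ⟨n, hn⟩).symm ▸ hν₀ ⟨n, hn⟩
    · exact (hνμ n hn).symm ▸ hμ0 n hn
  · by_cases hn : n ∈ J
    · have h1 := hνν₀ ⟨n, hn⟩
      have h2 := hΦx ⟨n, hn⟩
      simp only at h1 h2
      rw [h1, h2]
      exact hxk ⟨n, hn⟩
    · exact ⟨1, by simp [hνμ n hn, hΦb n hn, hR n hn]⟩
  · rw [ContinuousLinearEquiv.coeFn_ofBijective, hT₀]
    by_cases hn : n ∈ J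
    · have h2 := hΦx ⟨n, hn⟩
      have h3 := hπb ⟨n, hn⟩
      simp only at h2 h3
      rw [h2, h3, hXa, hinc]
      simp [Pi.single_apply]
    · have : π (b n) = 0 := (hπ0 _).2 fun j hj => by
        rw [b.repr_self, lp.single_apply_ne _ _ _ (by rintro rfl; exact hn hj)]
      rw [this, hΦb n hn]
      simp
  · by_cases h0 : π y = 0
    · have : ∃ n, b.repr y n ≠ 0 := by
        by_contra! h
        exact hy (b.ext_repr fun n => by simp [h n])
      obtain ⟨n, hn⟩ := this
      have hnJ : n ∉ J := fun h => hn ((hπ0 y).1 h0 n h)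
      refine ⟨n, ?_⟩
      have h1 := b.repr_diagonal_apply hR ((hπ0 y).1 h0) n
      rw [hyz] at h1
      simp only [map_smul, lp.coeFn_smul, Pi.smul_apply, smul_eq_mul] at h1
      rw [hνμ n hnJ]
      exact (mul_right_cancel₀ hn h1).symm
    · obtain ⟨j, hj⟩ := hall z (π y) h0 (by rw [← hπR, hyz, map_smul])
      exact ⟨j, (hνν₀ j).trans hj⟩

/-- A bounded operator with dense range that has a family of eigenvectors quadratically close to a
Riesz basis has a Riesz basis of root vectors, equal to the given family up to finitely many
indices, and whose eigenvalues are all the eigenvalues. -/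
theorem HilbertBasis.exists_riesz_basis_of_root_vectors [CompleteSpace H] (b : HilbertBasis ι ℂ H)
    {R : H →L[ℂ] H} (hRd : DenseRange R) (S : H ≃L[ℂ] H) {F : ι → H}
    (hF : Summable fun n => ‖F n - S (b n)‖ ^ 2) {μ : ι → ℂ} {J₀ : Finset ι}
    (hR : ∀ n ∉ J₀, R (F n) = μ n • F n) (hμ : Tendsto μ cofinite (nhds 0))
    (hμ0 : ∀ n ∉ J₀, μ n ≠ 0) :
    ∃ (J : Finset ι) (ν : ι → ℂ) (Φ : ι → H), (∀ n ∉ J, ν n = μ n) ∧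
      (∀ n, ν n ≠ 0) ∧ (∀ n, ∃ k : ℕ, ((R - ν n • (1 : H →L[ℂ] H)) ^ k) (Φ n) = 0) ∧
      IsRieszBasis Φ ∧ ∀ z x, x ≠ 0 → R x = z • x → ∃ n, ν n = z := by
  obtain ⟨J, hJ, T, hT⟩ := b.exists_equiv_of_summable S F hF J₀
  -- Conjugation by `T` turns the eigenvectors `F n`, `n ∉ J`, into members of the orthonormal
  -- basis, so the block triangular argument applies.
  let R' : H →L[ℂ] H := (T.symm : H →L[ℂ] H) ∘L R ∘L (T : H →L[ℂ] H)
  have hR'a : ∀ x, R' x = T.symm (R (T x)) := fun x => rfl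
  have hR' : ∀ n ∉ J, R' (b n) = μ n • b n := fun n hn => by
    rw [hR'a, hT n hn, hR n (fun h => hn (hJ h)), map_smul, ← hT n hn, T.symm_apply_apply]
  have hd : DenseRange R' :=
    T.symm.surjective.denseRange.comp
      ((hRd.comp T.surjective.denseRange R.continuous)) T.symm.continuous
  obtain ⟨ν, Φ, T', h1, h2, h3, h4, h5⟩ :=
    b.exists_root_vectors hd hR' hμ (fun n hn => hμ0 n fun h => hn (hJ h))
  refine ⟨J, ν, fun n => T (Φ n), fun n hn => (h1 n hn).1, h2, fun n => ?_,
    ⟨b, T'.trans T, fun n => by simp [h4]⟩, fun z x hx hxz => ?_⟩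
  · obtain ⟨k, hk⟩ := h3 n
    have hconj : ∀ (k : ℕ) (x : H), ((R - ν n • (1 : H →L[ℂ] H)) ^ k) (T x) =
        T (((R' - ν n • (1 : H →L[ℂ] H)) ^ k) x) := by
      intro k
      induction k with
      | zero => intro x; simp
      | succ k ih =>
        intro x
        rw [pow_succ, pow_succ, mul_apply_eq_comp, mul_apply_eq_comp, ← ih]
        congr 1
        simp [hR'a]
    exact ⟨k, by rw [hconj, hk, map_zero]⟩
  · refine h5 z (T.symm x) (by simpa using hx) ?_
    rw [hR'a, T.apply_symm_apply, hxz, map_smul]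

end RootVectors

/-! ### Compactness of integration and passage to interval integrals. -/

section Volterra

/-- The class of the indicator function of `[0, x]`. -/
noncomputable def indIic (x : I) : L2 :=
  indicatorConstLp 2 (measurableSet_Iic (a := x)) (measure_ne_top _ _) (1 : ℂ)

lemma setIntegral_Iic_eq_inner (v : L2) (x : I) : ∫ t in Iic x, v t = inner ℂ (indIic x) v :=
  (L2.inner_indicatorConstLp_one _ _ v).symm

/-- The difference is the indicator of an interval, whose `L²` norm is the square root of its
length. This Hölder modulus gives both the continuity of primitives and the equicontinuity behind
compactness. -/
lemma dist_indIic_le (x y : I) : dist (indIic x) (indIic y) ≤ √(dist x y) := by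
  wlog h : x ≤ y generalizing x y
  · rw [dist_comm, dist_comm x]
    exact this y x (le_of_not_ge h)
  have hd : symmDiff (Iic x) (Iic y) = Ioc x y := by
    rw [symmDiff_of_le (Iic_subset_Iic.2 h)]
    exact Set.ext fun t => by simp [and_comm]
  have hm : (volume : Measure I).real (Ioc x y) = (y : ℝ) - x := by
    rw [measureReal_def, unitInterval.volume_Ioc, ENNReal.toReal_ofReal]
    exact sub_nonneg.2 h
  rw [indIic, indIic, dist_indicatorConstLp_eq_norm, norm_indicatorConstLp (by norm_num) (by norm_num)]
  simp only [hd, hm, norm_one, one_mul, ENNReal.toReal_ofNat, ← Real.sqrt_eq_rpow]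
  apply Real.sqrt_le_sqrt
  rw [dist_comm, Subtype.dist_eq, Real.dist_eq]
  exact le_abs_self _

lemma continuous_indIic : Continuous indIic := by
  refine continuous_iff_continuousAt.2 fun x => tendsto_iff_dist_tendsto_zero.2 ?_
  refine squeeze_zero (fun _ => dist_nonneg) (fun y => dist_indIic_le y x) ?_
  have : Continuous fun y : I => √(dist y x) := by fun_prop
  simpa using this.tendsto x

lemma norm_indIic_le (x : I) : ‖indIic x‖ ≤ 1 := by
  have hm : (volume : Measure I).real (Iic x) = x := by
    rw [measureReal_def, unitInterval.volume_Iic, ENNReal.toReal_ofReal x.2.1]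
  rw [indIic, norm_indicatorConstLp (by norm_num) (by norm_num), hm]
  simp only [norm_one, one_mul, ENNReal.toReal_ofNat, ← Real.sqrt_eq_rpow]
  exact Real.sqrt_le_one.2 x.2.2

/-- The Volterra operator `v ↦ ∫₀ˣ v`, with values in the continuous functions. -/
noncomputable def volterra : L2 →L[ℂ] C(I, ℂ) :=
  LinearMap.mkContinuous
    { toFun := fun v => ⟨fun x => inner ℂ (indIic x) v, continuous_indIic.inner continuous_const⟩
      map_add' := fun v w => by ext x; simp [inner_add_right]
      map_smul' := fun c v => by ext x; simp [inner_smul_right] } 1 fun v => by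
    rw [ContinuousMap.norm_le _ (by positivity)]
    intro x
    exact (norm_inner_le_norm _ _).trans 
      (mul_le_mul_of_nonneg_right (norm_indIic_le x) (norm_nonneg v))

lemma volterra_apply (v : L2) (x : I) : volterra v x = ∫ t in Iic x, v t :=
  (setIntegral_Iic_eq_inner v x).symm

lemma mem_H1_iff {p : C(I, ℂ) × L2} : p ∈ H1 ↔ ∀ x, p.1 x = p.1 0 + volterra p.2 x := by
  simp only [volterra_apply]
  rfl

@[simp] lemma volterra_zero (v : L2) : volterra v 0 = 0 := by
  have : (volume : Measure I) (Iic 0) = 0 := by simp [unitInterval.volume_Iic]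
  rw [volterra_apply, setIntegral_measure_zero _ this]

/-- Arzelà–Ascoli: primitives of functions in the unit ball are bounded by 1 and share the modulus
of continuity `√d`. -/
lemma isCompactOperator_volterra : IsCompactOperator volterra := by
  refine (isCompactOperator_iff_isCompact_closure_image_closedBall
    (volterra : L2 →ₗ[ℂ] C(I, ℂ)) one_pos).2 ?_
  let e := ContinuousMap.equivBoundedOfCompact I ℂ
  have he : Isometry e := ContinuousMap.isometryEquivBoundedOfCompact I ℂ |>.isometry
  set A := (volterra : L2 →ₗ[ℂ] C(I, ℂ)) '' Metric.closedBall 0 1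
  have key : IsCompact (closure (e '' A)) := by
    refine BoundedContinuousFunction.arzela_ascoli (Metric.closedBall (0 : ℂ) 1)
      (isCompact_closedBall _ _) _ ?_ ?_
    · rintro _ x ⟨_, ⟨v, hv, rfl⟩, rfl⟩
      rw [mem_closedBall_zero_iff] at hv ⊢
      change ‖inner ℂ (indIic x) v‖ ≤ 1
      exact (norm_inner_le_norm _ _).trans (mul_le_one₀ (norm_indIic_le x) (norm_nonneg _) hv)
    · refine Metric.equicontinuous_of_continuity_modulus (fun d => √d) ?_ _ ?_
      · have : Continuous fun d => √d := by fun_prop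
        simpa using this.tendsto 0
      · rintro x y ⟨_, _, ⟨v, hv, rfl⟩, rfl⟩
        rw [mem_closedBall_zero_iff] at hv
        change dist (inner ℂ (indIic x) v) (inner ℂ (indIic y) v) ≤ _
        rw [dist_eq_norm, ← inner_sub_left]
        refine (norm_inner_le_norm _ _).trans ?_
        rw [← dist_eq_norm]
        exact (mul_le_of_le_one_right dist_nonneg hv).trans (dist_indIic_le x y)
  have hs : e.symm '' (closure (e '' A)) = closure A := by
    have h := (ContinuousMap.isometryEquivBoundedOfCompact I ℂ).symm.toHomeomorph.image_closure
      (e '' A)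
    have h2 : e.symm '' (e '' A) = A := by simp [image_image]
    exact h.trans (congrArg closure h2)
  rw [← hs]
  exact key.image (ContinuousMap.isometryEquivBoundedOfCompact I ℂ).symm.continuous

lemma setIntegral_Iic_unitInterval (f : ℝ → ℂ) (x : I) :
    ∫ t in Iic x, f (t : ℝ) = ∫ t in (0 : ℝ)..x, f t := by
  have h := (MeasurableEmbedding.subtype_coe (measurableSet_Icc : MeasurableSet I)).setIntegral_map
    (μ := volume) f (Iic (x : ℝ))
  have h1 : Measure.map ((↑) : I → ℝ) volume = volume.restrict I :=
    map_comap_subtype_coe measurableSet_Icc _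
  rw [h1, Measure.restrict_restrict measurableSet_Iic] at h
  have h2 : Iic (x : ℝ) ∩ I = Icc 0 (x : ℝ) := by
    ext t
    simp only [mem_inter_iff, mem_Iic, mem_Icc]
    exact ⟨fun h => ⟨h.2.1, h.1⟩, fun h => ⟨h.2, h.1, h.2.trans x.2.2⟩⟩
  rw [h2, integral_Icc_eq_integral_Ioc, ← intervalIntegral.integral_of_le x.2.1] at h
  exact h.symm

lemma integral_unitInterval (f : ℝ → ℂ) : ∫ t : I, f t = ∫ t in (0 : ℝ)..1, f t := by
  have := setIntegral_Iic_unitInterval f 1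
  rwa [show Iic (1 : I) = univ from Set.eq_univ_of_forall fun x => unitInterval.le_one',
    setIntegral_univ] at this

lemma volterra_toL2 (φ : C(I, ℂ)) (x : I) :
    volterra (toL2 φ) x = ∫ t in (0 : ℝ)..x, IccExtend zero_le_one φ t := by
  rw [volterra_apply, ← setIntegral_Iic_unitInterval]
  refine integral_congr_ae (ae_restrict_of_ae ?_)
  filter_upwards [ContinuousMap.coeFn_toLp (p := 2) (𝕜 := ℂ) (volume : Measure I) φ] with t ht
  rw [ht, IccExtend_val]

/-- The restriction to `[0,1]` of a continuous function. -/
def restrI (f : ℝ → ℂ) (hf : Continuous f) : C(I, ℂ) := ⟨fun x => f x, by fun_prop⟩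

@[simp] lemma restrI_apply (f : ℝ → ℂ) (hf : Continuous f) (x : I) : restrI f hf x = f x := rfl

lemma volterra_toL2_restrI_deriv {f f' : ℝ → ℂ} (hf : ∀ t, HasDerivAt f (f' t) t)
    (hf' : Continuous f') (x : I) : volterra (toL2 (restrI f' hf')) x = f x - f 0 := by
  rw [volterra_apply, ← intervalIntegral.integral_eq_sub_of_hasDerivAt (fun t _ => hf t)
    (hf'.intervalIntegrable _ _), ← setIntegral_Iic_unitInterval]
  refine integral_congr_ae (ae_restrict_of_ae ?_)
  filter_upwards [ContinuousMap.coeFn_toLp (p := 2) (𝕜 := ℂ) (volume : Measure I)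
    (restrI f' hf')] with t ht
  rw [ht, restrI_apply]

lemma restrI_mem_H1 {f f' : ℝ → ℂ} (hf : ∀ t, HasDerivAt f (f' t) t) (hf' : Continuous f')
    (hfc : Continuous f) : (restrI f hfc, toL2 (restrI f' hf')) ∈ H1 := by
  rw [mem_H1_iff]
  intro x
  simp [volterra_toL2_restrI_deriv hf hf' x]

end Volterra

/-! ### Differentiation identifies `H1e` with `L²`. -/

section Sobolev

namespace H1e

/-- The element of `H¹ₑ(0,1)` with a given derivative. -/
noncomputable def ofDeriv (v : L2) : H1e :=
  ⟨(volterra v - ContinuousMap.const I (volterra v 1), v), by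
    rw [mem_H1_iff]; intro x; simp; ring, by simp⟩

@[simp] lemma deriv_ofDeriv (v : L2) : (ofDeriv v).deriv = v := rfl

lemma fn_ofDeriv (v : L2) : (ofDeriv v).fn = volterra v - ContinuousMap.const I (volterra v 1) :=
  rfl

lemma ext_deriv {f h : H1e} (e : f.deriv = h.deriv) : f = h := by
  rw [← sub_eq_zero]
  exact eq_zero_of_deriv (by rw [map_sub, e, sub_self])

lemma norm_eq (f : H1e) : ‖f‖ = ‖f.deriv‖ :=
  (norm_eq_sqrt_re_inner (𝕜 := ℂ) f).trans (norm_eq_sqrt_re_inner (𝕜 := ℂ) f.deriv).symm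

/-- Differentiation as an isometry of `H¹ₑ(0,1)` onto `L²(0,1)`. -/
noncomputable def derivEquiv : H1e ≃ₗᵢ[ℂ] L2 where
  toLinearEquiv := LinearEquiv.ofLinearMap deriv
    { toFun := ofDeriv
      map_add' := fun v w => ext_deriv (by simp)
      map_smul' := fun c v => ext_deriv (by simp) }
    (LinearMap.ext fun _ => rfl) (LinearMap.ext fun _ => ext_deriv rfl)
  norm_map' f := (norm_eq f).symm

instance : CompleteSpace H1e :=
  (completeSpace_congr (e := derivEquiv.toEquiv) derivEquiv.isometry.isUniformEmbedding).2
    inferInstance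

end H1e

end Sobolev

/-! ### Spectral dictionary between an unbounded operator and its bounded inverse. -/

section InverseGraph

variable {H : Type*} [NormedAddCommGroup H] [InnerProductSpace ℂ H] {A : H →ₗ.[ℂ] H}
  {R : H →L[ℂ] H}

lemma LinearPMap.mem_domain_iff_of_graph_eq_inverse (hA : ∀ x y, (x, y) ∈ A.graph ↔ x = R y)
    {x : H} : x ∈ A.domain ↔ ∃ y, x = R y := by
  rw [LinearPMap.mem_domain_iff]
  simp only [hA]

lemma LinearPMap.apply_eq_iff_of_graph_eq_inverse (hA : ∀ x y, (x, y) ∈ A.graph ↔ x = R y)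
    {x y : H} (hx : x ∈ A.domain) : A ⟨x, hx⟩ = y ↔ x = R y := by
  rw [eq_comm, LinearPMap.image_iff, hA]

lemma isResolventAt_zero_of_graph_eq_inverse (hA : ∀ x y, (x, y) ∈ A.graph ↔ x = R y) :
    IsResolventAt A 0 (-R) := by
  refine ⟨fun y => ?_, fun x => ?_⟩
  · have hm : (-R) y ∈ A.domain :=
      (LinearPMap.mem_domain_iff_of_graph_eq_inverse hA).2 ⟨-y, by simp⟩
    refine ⟨hm, ?_⟩
    have : A ⟨(-R) y, hm⟩ = -y :=
      (LinearPMap.apply_eq_iff_of_graph_eq_inverse hA hm).2 (by simp)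
    rw [this, zero_smul, zero_sub, neg_neg]
  · have := (LinearPMap.apply_eq_iff_of_graph_eq_inverse hA x.2).1 rfl
    simpa using this.symm

lemma isEigenvector_iff_of_graph_eq_inverse (hA : ∀ x y, (x, y) ∈ A.graph ↔ x = R y) {z : ℂ}
    {x : H} : IsEigenvector A z x ↔ x ≠ 0 ∧ x = z • R x := by
  refine and_congr_right fun _ => ⟨fun ⟨h, e⟩ => ?_, fun e => ?_⟩
  · rw [LinearPMap.apply_eq_iff_of_graph_eq_inverse hA, map_smul] at e
    exact e
  · rw [← map_smul] at e
    have hx := (LinearPMap.mem_domain_iff_of_graph_eq_inverse hA).2 ⟨_, e⟩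
    exact ⟨hx, (LinearPMap.apply_eq_iff_of_graph_eq_inverse hA hx).2 e⟩

/-- Formally `A - ν⁻¹ = -ν⁻¹ R⁻¹ (R - ν)`, and `R` commutes with `R - ν`. The real content is that
every iterate stays in the domain of `A`. -/
lemma powKills_of_pow_sub_smul_apply_eq_zero (hA : ∀ x y, (x, y) ∈ A.graph ↔ x = R y)
    (hR : Function.Injective R) {ν : ℂ} (hν : ν ≠ 0) (k : ℕ) {x : H}
    (hx : ((R - ν • (1 : H →L[ℂ] H)) ^ k) x = 0) : PowKills A ν⁻¹ k x := by
  have hcomm : ∀ (k : ℕ) (y : H), ((R - ν • (1 : H →L[ℂ] H)) ^ k) (R y) =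
      R (((R - ν • (1 : H →L[ℂ] H)) ^ k) y) := fun k y => by
    have : Commute ((R - ν • (1 : H →L[ℂ] H)) ^ k) R :=
      ((Commute.refl R).sub_left ((Commute.one_left R).smul_left ν)).pow_left k
    exact congrArg (fun T : H →L[ℂ] H => T y) this.eq
  induction k generalizing x with
  | zero => exact hx
  | succ k ih =>
    rw [pow_succ, mul_apply_eq_comp] at hx
    set y := (R - ν • (1 : H →L[ℂ] H)) x with hy
    have hyx : y = R x - ν • x := rfl
    -- The induction hypothesis applied to `y = (R - ν) x` puts `y` in the domain, that is, in the
    -- range of `R`. Then `x = ν⁻¹ (R x - y)` lies there too.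
    have hrange : ∃ u, y = R u := by
      have h := ih hx
      cases k with
      | zero => exact ⟨0, by rw [map_zero]; exact h⟩
      | succ k => exact (LinearPMap.mem_domain_iff_of_graph_eq_inverse hA).1 h.1
    obtain ⟨u, hu⟩ := hrange
    have hxR : x = R (ν⁻¹ • (x - u)) := by
      rw [map_smul, map_sub, ← hu, hyx, sub_sub_cancel, smul_smul, inv_mul_cancel₀ hν, one_smul]
    have hxd := (LinearPMap.mem_domain_iff_of_graph_eq_inverse hA).2 ⟨_, hxR⟩
    refine ⟨hxd, ?_⟩
    rw [(LinearPMap.apply_eq_iff_of_graph_eq_inverse hA hxd).2 hxR]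
    have hw : ν⁻¹ • (x - u) - ν⁻¹ • x = -ν⁻¹ • u := by rw [← smul_sub]; simp
    rw [hw]
    refine ih (hR ?_)
    rw [← hcomm, map_smul, ← hu, map_smul, hx, smul_zero, map_zero]

/-- The last nonzero iterate of `R - ν` on a root vector is an eigenvector. -/
lemma isEigenvalue_of_pow_sub_smul_apply_eq_zero (hA : ∀ x y, (x, y) ∈ A.graph ↔ x = R y)
    {ν : ℂ} (hν : ν ≠ 0) (k : ℕ) {x : H} (hx0 : x ≠ 0)
    (hx : ((R - ν • (1 : H →L[ℂ] H)) ^ k) x = 0) : IsEigenvalue A ν⁻¹ := by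
  induction k generalizing x with
  | zero => exact absurd (by simpa using hx) hx0
  | succ k ih =>
    rw [pow_succ, mul_apply_eq_comp] at hx
    by_cases h : (R - ν • (1 : H →L[ℂ] H)) x = 0
    · refine ⟨x, (isEigenvector_iff_of_graph_eq_inverse hA).2 ⟨hx0, ?_⟩⟩
      have h' : R x = ν • x := sub_eq_zero.1 h
      rw [h', smul_smul, inv_mul_cancel₀ hν, one_smul]
    · exact ih h hx

end InverseGraph

/-! ### The explicit compact inverse of the wave operator. -/

section WaveInverse

/-- The integral over `[0,1]` of a continuous function, as a functional. -/
noncomputable def integralI : C(I, ℂ) →L[ℂ] ℂ :=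
  ContinuousMap.evalCLM ℂ 1 ∘L volterra ∘L toL2

lemma integralI_apply (φ : C(I, ℂ)) : integralI φ = volterra (toL2 φ) 1 := rfl

lemma volterra_toL2_const (c : ℂ) (x : I) :
    volterra (toL2 (ContinuousMap.const I c)) x = c * x := by
  rw [volterra_toL2]
  have : IccExtend zero_le_one (ContinuousMap.const I c : I → ℂ) = fun _ => c := rfl
  rw [this]
  simp [mul_comm]

/-- The inclusion of the first coordinate `f' ∈ L²(0,1)` into the state space. -/
noncomputable def inclFst : L2 →L[ℂ] StateSpace :=
  (WithLp.prodContinuousLinearEquiv 2 ℂ H1e L2).symm.toContinuousLinearMap ∘L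
    ContinuousLinearMap.inl ℂ H1e L2 ∘L H1e.derivEquiv.symm.toContinuousLinearEquiv

/-- The inclusion of the second coordinate `g ∈ L²(0,1)` into the state space. -/
noncomputable def inclSnd : L2 →L[ℂ] StateSpace :=
  (WithLp.prodContinuousLinearEquiv 2 ℂ H1e L2).symm.toContinuousLinearMap ∘L
    ContinuousLinearMap.inr ℂ H1e L2

lemma StateSpace.ext' {X Y : StateSpace} (h₁ : X.fst.deriv = Y.fst.deriv) (h₂ : X.snd = Y.snd) :
    X = Y :=
  WithLp.ofLp_injective 2 (Prod.ext (H1e.ext_deriv h₁) h₂)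

/-- The first coordinate `f'` of a state. -/
noncomputable def coordFst : StateSpace →L[ℂ] L2 :=
  H1e.derivEquiv.toContinuousLinearEquiv.toContinuousLinearMap ∘L WithLp.fstL 2 ℂ H1e L2

/-- The second coordinate `g` of a state. -/
noncomputable def coordSnd : StateSpace →L[ℂ] L2 := WithLp.sndL 2 ℂ H1e L2

variable (γ β : ℝ)

/-- The part of the inverse of the wave operator depending on `∫₀ˣ g`. -/
noncomputable def waveInvSnd : C(I, ℂ) →L[ℂ] StateSpace :=
  inclFst ∘L toL2 ∘L (1 - (((β / (1 + β) : ℝ) : ℂ) • integralI).smulRight 1)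

/-- The part of the inverse of the wave operator depending on `∫₀ˣ f'`. -/
noncomputable def waveInvFst : C(I, ℂ) →L[ℂ] StateSpace :=
  inclFst ∘L toL2 ∘L
      (-((γ / (1 + β) : ℝ) : ℂ) • ContinuousMap.evalCLM ℂ (1 : I)).smulRight 1 +
    inclSnd ∘L toL2 ∘L (1 - (ContinuousMap.evalCLM ℂ (1 : I)).smulRight 1)

/-- The inverse of the wave operator. -/
noncomputable def waveInv : StateSpace →L[ℂ] StateSpace :=
  waveInvSnd β ∘L volterra ∘L coordSnd + waveInvFst γ β ∘L volterra ∘L coordFst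

lemma isCompactOperator_waveInv : IsCompactOperator (waveInv γ β) :=
  ((isCompactOperator_volterra.comp_clm coordSnd).clm_comp (waveInvSnd β)).add
    ((isCompactOperator_volterra.comp_clm coordFst).clm_comp (waveInvFst γ β))

variable {γ β}

lemma waveInv_mem_waveGraph (hβ : 0 < β) (Y : StateSpace) : (waveInv γ β Y, Y) ∈ waveGraph γ β := by
  set w := volterra Y.fst.deriv with hw
  set u := volterra Y.snd with hu
  -- Here `f' = u + c`, and `f(1) = 0` gives `f(0) = -(∫ u + c)`, while the first component of `Y`
  -- has value `-w 1` at `0`. The boundary condition then reads `(1 + β) c = -γ w 1 - β ∫ u`, which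
  -- determines `c` and explains the denominators in `waveInvSnd` and `waveInvFst`.
  set c : ℂ := -((γ / (1 + β) : ℝ) : ℂ) * w 1 - ((β / (1 + β) : ℝ) : ℂ) * integralI u with hc
  have hfn : Y.fst.fn = w - ContinuousMap.const I (w 1) := by
    conv_lhs => rw [show Y.fst = H1e.ofDeriv Y.fst.deriv from H1e.ext_deriv rfl]
    rfl
  have hsnd : (waveInv γ β Y).snd = toL2 (w - ContinuousMap.const I (w 1)) := by
    have : (waveInv γ β Y).snd =
        0 + (0 + toL2 (w - w 1 • (1 : C(I, ℂ)))) := rfl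
    rw [this, zero_add, zero_add]
    congr 2
    ext x; simp
  have hfst : (waveInv γ β Y).fst = H1e.ofDeriv (toL2 (u + ContinuousMap.const I c)) := by
    apply H1e.ext_deriv
    have : (waveInv γ β Y).fst.deriv =
        toL2 (u - (((β / (1 + β) : ℝ) : ℂ) • integralI u) • (1 : C(I, ℂ))) +
        (toL2 ((-((γ / (1 + β) : ℝ) : ℂ) • w 1) • (1 : C(I, ℂ))) + 0) := rfl
    rw [this, add_zero, ← map_add, H1e.deriv_ofDeriv]
    congr 1
    ext x
    simp [hc]
    ring
  refine ⟨by rw [hsnd, hfn], (u + ContinuousMap.const I c, Y.snd), ?_, ?_, rfl, ?_⟩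
  · rw [mem_H1_iff]
    intro x
    simp [hu]
    ring
  · simp only [hfst, H1e.deriv_ofDeriv]
  · have h1 : (1 + β : ℂ) ≠ 0 := by exact_mod_cast (by positivity : (1 + β) ≠ 0)
    have h2 : volterra (toL2 (u + ContinuousMap.const I c)) 1 = integralI u + c := by
      rw [map_add, map_add, ContinuousMap.add_apply, volterra_toL2_const, integralI_apply]
      simp
    have hu0 : u 0 = 0 := volterra_zero _
    have hw0 : w 0 = 0 := volterra_zero _
    simp only [hfst, hfn, H1e.fn_ofDeriv, ContinuousMap.sub_apply, ContinuousMap.const_apply,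
      ContinuousMap.add_apply, h2, hu0, hw0, volterra_zero]
    rw [hc]
    push_cast
    field_simp
    ring

/-- With `f'' = 0` and `g = 0`, the derivative is a constant `c` and `f(0) = -c`, so the boundary
condition becomes `(1 + β) c = 0`. -/
lemma fst_eq_zero_of_mem_waveGraph (hβ : 0 < β) {X : StateSpace} (h : (X, 0) ∈ waveGraph γ β) :
    X = 0 := by
  obtain ⟨h1, p, hp, h2, h3, h4⟩ := h
  have hsnd : X.snd = 0 := by simpa using h1.symm
  have hp1 : p.1 = ContinuousMap.const I (p.1 0) := by
    ext x
    have := (mem_H1_iff.1 hp) x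
    have h3' : p.2 = 0 := h3
    rw [this, h3']; simp
  have hfn0 : X.fst.fn 0 = -p.1 0 := by
    have : X.fst = H1e.ofDeriv (toL2 (ContinuousMap.const I (p.1 0))) :=
      H1e.ext_deriv (by rw [← hp1]; exact h2.symm)
    rw [this, H1e.fn_ofDeriv]
    simp [volterra_toL2_const]
  have h5 : p.1 0 = β * X.fst.fn 0 := by simpa using h4
  have h6 : p.1 0 = 0 := by
    have h1 : (1 + β : ℂ) ≠ 0 := by exact_mod_cast (by positivity : (1 + β) ≠ 0)
    have : (1 + β : ℂ) * p.1 0 = 0 := by linear_combination h5 + β * hfn0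
    exact (mul_eq_zero.1 this).resolve_left h1
  refine StateSpace.ext' ?_ hsnd
  change X.fst.deriv = 0
  rw [← h2, hp1, h6]
  exact map_zero toL2

/-- `waveInv` is a right inverse and the kernel is trivial. All domain questions are henceforth
settled through this equivalence. -/
lemma mem_waveGraph_iff (hβ : 0 < β) (X Y : StateSpace) :
    (X, Y) ∈ waveGraph γ β ↔ X = waveInv γ β Y := by
  refine ⟨fun h => ?_, fun h => h ▸ waveInv_mem_waveGraph hβ Y⟩
  have := (waveGraph γ β).sub_mem h (waveInv_mem_waveGraph hβ Y)
  rw [Prod.mk_sub_mk, sub_self] at this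
  exact sub_eq_zero.1 (fst_eq_zero_of_mem_waveGraph hβ this)

lemma mem_waveOperator_graph_iff (hβ : 0 < β) (X Y : StateSpace) :
    (X, Y) ∈ (waveOperator γ β).graph ↔ X = waveInv γ β Y := by
  rw [waveOperator_graph, mem_waveGraph_iff hβ]

lemma waveInv_injective (hβ : 0 < β) : Function.Injective (waveInv γ β) := by
  rw [injective_iff_map_eq_zero]
  intro Y hY
  exact waveGraph_functional γ β _ (waveInv_mem_waveGraph hβ Y) hY

lemma isDiscreteOperator_waveOperator (hβ : 0 < β) : IsDiscreteOperator (waveOperator γ β) :=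
  ⟨0, -waveInv γ β, isResolventAt_zero_of_graph_eq_inverse (mem_waveOperator_graph_iff hβ),
    (isCompactOperator_waveInv γ β).neg⟩

end WaveInverse

/-! ### Exponential states, the characteristic equation and uniqueness of eigenvectors. -/

section ExponentialStates

/-- The function `x ↦ cosh (z (x - 1))`. -/
noncomputable def coshI (z : ℂ) : C(I, ℂ) :=
  restrI (fun x => Complex.cosh (z * (x - 1))) (by fun_prop)

/-- The function `x ↦ sinh (z (x - 1))`. -/
noncomputable def sinhI (z : ℂ) : C(I, ℂ) :=
  restrI (fun x => Complex.sinh (z * (x - 1))) (by fun_prop)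

lemma coshI_apply (z : ℂ) (x : I) : coshI z x = Complex.cosh (z * ((x : ℝ) - 1)) := rfl
lemma sinhI_apply (z : ℂ) (x : I) : sinhI z x = Complex.sinh (z * ((x : ℝ) - 1)) := rfl

lemma coshI_add (z w : ℂ) : coshI (z + w) = coshI z * coshI w + sinhI z * sinhI w := by
  ext x
  simp only [coshI_apply, sinhI_apply, ContinuousMap.add_apply, ContinuousMap.mul_apply]
  rw [add_mul, Complex.cosh_add]

lemma sinhI_add (z w : ℂ) : sinhI (z + w) = sinhI z * coshI w + coshI z * sinhI w := by
  ext x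
  simp only [coshI_apply, sinhI_apply, ContinuousMap.add_apply, ContinuousMap.mul_apply]
  rw [add_mul, Complex.sinh_add]

lemma coshI_neg (z : ℂ) : coshI (-z) = coshI z := by
  ext x
  simp [coshI_apply]

lemma sinhI_neg (z : ℂ) : sinhI (-z) = -sinhI z := by
  ext x
  simp [sinhI_apply]

lemma coshI_zero : coshI 0 = 1 := by
  ext x
  simp [coshI_apply]

lemma sinhI_zero : sinhI 0 = 0 := by
  ext x
  simp [sinhI_apply]

lemma hasDerivAt_cosh_mul_sub_one (z : ℂ) (t : ℝ) :
    HasDerivAt (fun x : ℝ => Complex.cosh (z * (x - 1))) (z * Complex.sinh (z * (t - 1))) t := by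
  have h1 : HasDerivAt (fun x : ℝ => z * ((x : ℂ) - 1)) z t := by
    simpa using ((Complex.ofRealCLM.hasDerivAt (x := t)).sub_const 1).const_mul z
  rw [mul_comm z (Complex.sinh _)]
  exact (Complex.hasDerivAt_cosh (z * (t - 1))).comp t h1

lemma hasDerivAt_sinh_mul_sub_one (z : ℂ) (t : ℝ) :
    HasDerivAt (fun x : ℝ => Complex.sinh (z * (x - 1))) (z * Complex.cosh (z * (t - 1))) t := by
  have h1 : HasDerivAt (fun x : ℝ => z * ((x : ℂ) - 1)) z t := by
    simpa using ((Complex.ofRealCLM.hasDerivAt (x := t)).sub_const 1).const_mul z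
  rw [mul_comm z (Complex.cosh _)]
  exact (Complex.hasDerivAt_sinh (z * (t - 1))).comp t h1

/-- The state `(f, g)` with `f' = cosh (z (x - 1))` and `g = sinh (z (x - 1))`. -/
noncomputable def expState (z : ℂ) : StateSpace := inclFst (toL2 (coshI z)) + inclSnd (toL2 (sinhI z))

@[simp] lemma expState_deriv (z : ℂ) : (expState z).fst.deriv = toL2 (coshI z) :=
  add_zero _

@[simp] lemma expState_snd (z : ℂ) : (expState z).snd = toL2 (sinhI z) :=
  zero_add _

lemma fn_eq_of_deriv_eq_restrI {a : H1e} {f f' : ℝ → ℂ} (hf : ∀ t, HasDerivAt f (f' t) t)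
    (hf' : Continuous f') (h1 : f 1 = 0) (ha : a.deriv = toL2 (restrI f' hf')) (x : I) :
    a.fn x = f x := by
  rw [show a = H1e.ofDeriv (toL2 (restrI f' hf')) from H1e.ext_deriv ha, H1e.fn_ofDeriv,
    ContinuousMap.sub_apply, ContinuousMap.const_apply, volterra_toL2_restrI_deriv hf,
    volterra_toL2_restrI_deriv hf]
  simp [h1]

lemma expState_fn {z : ℂ} (hz : z ≠ 0) (x : I) : (expState z).fst.fn x = z⁻¹ * sinhFn z x :=
  fn_eq_of_deriv_eq_restrI (f := fun t => z⁻¹ * sinhFn z t)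
    (f' := fun x => Complex.cosh (z * (x - 1)))
    (fun t => by
      simpa [sinhFn, hz] using (hasDerivAt_sinh_mul_sub_one z t).const_mul z⁻¹)
    (by fun_prop) (by simp [sinhFn]) (expState_deriv z) x

lemma expState_ne_zero (z : ℂ) : expState z ≠ 0 := by
  intro h
  have h1 : toL2 (coshI z) = 0 := by rw [← expState_deriv, h]; exact map_zero _
  have h2 : coshI z = 0 := ContinuousMap.toLp_injective (𝕜 := ℂ) (p := 2)
    (volume : Measure I) (h1.trans (map_zero _).symm)
  have h3 : coshI z 1 = 0 := by rw [h2]; rfl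
  simp [coshI_apply] at h3

/-- If `z` solves the characteristic equation, then `expState z` is an eigenvector. -/
lemma expState_mem_waveGraph {γ β : ℝ} {z : ℂ} (hz : z ≠ 0)
    (h : z * Complex.cosh z + (γ * z + β) * Complex.sinh z = 0) :
    (expState z, z • expState z) ∈ waveGraph γ β := by
  have hfn : (z • expState z).fst.fn = sinhI z := by
    ext x
    change z * (expState z).fst.fn x = _
    rw [expState_fn hz, mul_inv_cancel_left₀ hz]
    rfl
  refine ⟨by rw [hfn, expState_snd], (coshI z, toL2 (z • sinhI z)), ?_, by simp, ?_, ?_⟩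
  · exact restrI_mem_H1 (hasDerivAt_cosh_mul_sub_one z) (by fun_prop) _
  · change _ = z • (expState z).snd
    rw [expState_snd, map_smul]
  · simp only [hfn, expState_fn hz, coshI_apply, sinhI_apply, sinhFn]
    simp only [Set.Icc.coe_zero, Complex.ofReal_zero, zero_sub, mul_neg, mul_one, Complex.cosh_neg,
      Complex.sinh_neg]
    field_simp
    linear_combination h

lemma continuous_IccExtend (φ : C(I, ℂ)) : Continuous (IccExtend zero_le_one φ) :=
  φ.continuous.Icc_extend'

/-- The solutions of `f'' = z² f`, `f(1) = 0` are multiples of `sinh (z (x - 1))`. -/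
lemma eq_smul_expState_of_mem_waveGraph {γ β : ℝ} {z : ℂ} {X : StateSpace}
    (h : (X, z • X) ∈ waveGraph γ β) : ∃ c : ℂ, X = c • expState z := by
  obtain ⟨h1, p, hp, h2, h3, -⟩ := h
  have h1' : X.snd = toL2 (z • X.fst.fn) := h1.symm
  have h3' : p.2 = toL2 (z ^ 2 • X.fst.fn) := by
    rw [h3]
    change z • X.snd = _
    rw [h1', ← map_smul, smul_smul, pow_two]
  set f := X.fst.fn with hf
  have h2' : X.fst.deriv = toL2 p.1 := h2.symm
  have hF : ∀ x : I, f x = f 0 + ∫ t in (0 : ℝ)..x, IccExtend zero_le_one p.1 t := fun x => by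
    rw [← volterra_toL2, ← h2', ← (mem_H1_iff.1 X.fst.mem_H1) x]
  have hP : ∀ x : I, p.1 x = p.1 0 + ∫ t in (0 : ℝ)..x, IccExtend zero_le_one (z ^ 2 • f) t :=
    fun x => by rw [← volterra_toL2, ← h3', ← (mem_H1_iff.1 hp) x]
  -- Primitives of continuous extensions to `ℝ` have classical derivatives everywhere and agree with
  -- `f` and `f'` on `[0,1]`.
  set F : ℝ → ℂ := fun s => f 0 + ∫ t in (0 : ℝ)..s, IccExtend zero_le_one p.1 t with hFdef
  set P : ℝ → ℂ := fun s => p.1 0 + ∫ t in (0 : ℝ)..s, IccExtend zero_le_one (z ^ 2 • f) t with hPdef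
  have hF' : ∀ s, HasDerivAt F (IccExtend zero_le_one p.1 s) s := fun s =>
    ((continuous_IccExtend p.1).integral_hasStrictDerivAt 0 s).hasDerivAt.const_add _
  have hP' : ∀ s, HasDerivAt P (IccExtend zero_le_one (z ^ 2 • f) s) s := fun s =>
    ((continuous_IccExtend (z ^ 2 • f)).integral_hasStrictDerivAt 0 s).hasDerivAt.const_add _
  -- The second-order equation factors: if `w² = z²`, then `y = f' + w f` satisfies `y' = w y`, and
  -- `f(1) = 0` fixes its value at `1`. Half the sum and half the difference of the cases `w = z`
  -- and `w = -z` give `f'` and `z f`, without dividing by `z`.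
  have key : ∀ w : ℂ, w ^ 2 = z ^ 2 → ∀ x : I,
      p.1 x + w * f x = p.1 1 * Complex.exp (w * ((x : ℝ) - 1)) := by
    intro w hw x
    have hd : ∀ s : ℝ, HasDerivAt (fun s : ℝ => Complex.exp (-w * (s - 1)))
        (-w * Complex.exp (-w * (s - 1))) s := fun s => by
      have h1 : HasDerivAt (fun x : ℝ => -w * ((x : ℂ) - 1)) (-w) s := by
        simpa using ((Complex.ofRealCLM.hasDerivAt (x := s)).sub_const 1).const_mul (-w)
      simpa [mul_comm] using h1.cexp
    have hG : ∀ s, HasDerivAt (fun s : ℝ => (P s + w * F s) * Complex.exp (-w * (s - 1)))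
        ((IccExtend zero_le_one (z ^ 2 • f) s + w * IccExtend zero_le_one p.1 s) *
          Complex.exp (-w * (s - 1)) +
          (P s + w * F s) * (-w * Complex.exp (-w * (s - 1)))) s := fun s =>
      ((hP' s).add ((hF' s).const_mul w)).mul (hd s)
    have hc := constant_of_has_deriv_right_zero (a := 0) (b := 1)
      (f := fun s : ℝ => (P s + w * F s) * Complex.exp (-w * (s - 1)))
      (fun s _ => (hG s).continuousAt.continuousWithinAt) (fun s hs => by
        have hs' : s ∈ I := ⟨hs.1, hs.2.le⟩
        have e1 : P s = p.1 ⟨s, hs'⟩ := (hP ⟨s, hs'⟩).symm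
        have e2 : F s = f ⟨s, hs'⟩ := (hF ⟨s, hs'⟩).symm
        have := (hG s).hasDerivWithinAt (s := Ici s)
        convert this using 1
        rw [IccExtend_of_mem _ _ hs', IccExtend_of_mem _ _ hs', e1, e2]
        simp only [ContinuousMap.smul_apply, smul_eq_mul]
        linear_combination (f ⟨s, hs'⟩ * Complex.exp (-w * (s - 1))) * hw)
    have hx := (hc x x.2).trans (hc 1 (by simp)).symm
    have e1 : P x = p.1 x := (hP x).symm
    have e2 : F x = f x := (hF x).symm
    have e3 : P 1 = p.1 1 := (hP 1).symm
    have e4 : F 1 = 0 := (hF 1).symm.trans X.fst.fn_one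
    simp only [e1, e2, e3, e4, mul_zero, add_zero, Complex.ofReal_one, sub_self, Complex.exp_zero,
      mul_one] at hx
    rw [← hx, mul_assoc, ← Complex.exp_add]
    simp
  have k1 := key z rfl
  have k2 := key (-z) (by ring)
  refine ⟨p.1 1, StateSpace.ext' ?_ ?_⟩
  · change X.fst.deriv = p.1 1 • (expState z).fst.deriv
    rw [h2', expState_deriv, ← map_smul]
    refine congrArg toL2 (ContinuousMap.ext fun x => ?_)
    simp only [ContinuousMap.smul_apply, smul_eq_mul, coshI_apply, Complex.cosh]
    have := k2 x
    rw [neg_mul] at this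
    rw [neg_mul] at this
    linear_combination (k1 x) / 2 + this / 2
  · change X.snd = p.1 1 • (expState z).snd
    rw [h1', expState_snd, ← map_smul toL2 (p.1 1)]
    refine congrArg toL2 (ContinuousMap.ext fun x => ?_)
    simp only [ContinuousMap.smul_apply, smul_eq_mul, sinhI_apply, Complex.sinh]
    have := k2 x
    rw [neg_mul] at this
    rw [neg_mul] at this
    linear_combination (k1 x) / 2 - this / 2

end ExponentialStates

/-! ### Multiplication operators and hyperbolic rotations of the state space. -/

section Multiplication

/-- Multiplication by a continuous function on `L²(0,1)`. -/
noncomputable def mulL (h : C(I, ℂ)) : L2 →L[ℂ] L2 :=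
  (ContinuousLinearMap.lsmul ℂ ℂ).holderL (volume : Measure I) ⊤ 2 2
    (ContinuousMap.toLp ⊤ volume ℂ h)

lemma coeFn_mulL (h : C(I, ℂ)) (v : L2) : mulL h v =ᵐ[volume] fun x => h x * v x := by
  have h1 := (ContinuousLinearMap.lsmul ℂ ℂ).coeFn_holder (r := 2)
    (ContinuousMap.toLp ⊤ (volume : Measure I) ℂ h) v
  have h2 := ContinuousMap.coeFn_toLp (p := ⊤) (𝕜 := ℂ) (volume : Measure I) h
  filter_upwards [h1, h2] with x hx1 hx2
  rw [← hx2]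
  exact hx1

lemma coeFn_toL2 (h : C(I, ℂ)) : toL2 h =ᵐ[volume] h :=
  ContinuousMap.coeFn_toLp (p := 2) (𝕜 := ℂ) (volume : Measure I) h

lemma mulL_toL2 (h k : C(I, ℂ)) : mulL h (toL2 k) = toL2 (h * k) := by
  refine Lp.ext ?_
  filter_upwards [coeFn_mulL h (toL2 k), coeFn_toL2 k, coeFn_toL2 (h * k)] with x h1 h2 h3
  rw [h1, h2, h3, ContinuousMap.mul_apply]

lemma mulL_mulL (h k : C(I, ℂ)) (v : L2) : mulL h (mulL k v) = mulL (h * k) v := by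
  refine Lp.ext ?_
  filter_upwards [coeFn_mulL h (mulL k v), coeFn_mulL k v, coeFn_mulL (h * k) v] with x h1 h2 h3
  rw [h1, h2, h3, ContinuousMap.mul_apply, mul_assoc]

lemma mulL_add (h k : C(I, ℂ)) : mulL (h + k) = mulL h + mulL k := by
  simp [mulL]

lemma mulL_zero : mulL 0 = 0 := by
  simp [mulL]

lemma mulL_one (v : L2) : mulL 1 v = v := by
  refine Lp.ext ?_
  filter_upwards [coeFn_mulL 1 v] with x h1
  rw [h1, ContinuousMap.one_apply, one_mul]

lemma inner_toL2_mul (k h : C(I, ℂ)) (v : L2) :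
    inner ℂ (toL2 (k * h)) v = inner ℂ (toL2 k) (mulL (star h) v) := by
  rw [L2.inner_def, L2.inner_def]
  refine integral_congr_ae ?_
  filter_upwards [coeFn_mulL (star h) v, coeFn_toL2 k, coeFn_toL2 (k * h)] with x h1 h2 h3
  rw [h1, h2, h3]
  simp only [RCLike.inner_apply, ContinuousMap.mul_apply, ContinuousMap.star_apply, map_mul]
  simp only [RCLike.star_def]
  ring

/-- An `L²` function orthogonal to all `k h` with `k` continuous vanishes if `h ≠ 0` a.e. -/
lemma L2.eq_zero_of_forall_inner_toL2_mul {h : C(I, ℂ)} (hh : ∀ᵐ x, h x ≠ 0) {v : L2}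
    (hv : ∀ k : C(I, ℂ), inner ℂ (toL2 (k * h)) v = 0) : v = 0 := by
  have h1 : mulL (star h) v = 0 := by
    have hd : DenseRange (toL2 : C(I, ℂ) → L2) :=
      ContinuousMap.toLp_denseRange ℂ volume ℂ (by norm_num)
    exact DenseRange.eq_zero_of_inner_right ℂ hd fun k => (inner_toL2_mul k h v).symm.trans (hv k)
  refine (Lp.eq_zero_iff_ae_eq_zero).2 ?_
  have h2 := (Lp.eq_zero_iff_ae_eq_zero).1 h1
  filter_upwards [h2, coeFn_mulL (star h) v, hh] with x e1 e2 e3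
  rw [e1] at e2
  have := mul_eq_zero.1 e2.symm
  exact this.resolve_left (by simpa using e3)

/-- Multiplication by `[[cosh z(x-1), sinh z(x-1)], [sinh z(x-1), cosh z(x-1)]]` of `(f', g)`. -/
noncomputable def hypRot (z : ℂ) : StateSpace →L[ℂ] StateSpace :=
  inclFst ∘L (mulL (coshI z) ∘L coordFst + mulL (sinhI z) ∘L coordSnd) +
    inclSnd ∘L (mulL (sinhI z) ∘L coordFst + mulL (coshI z) ∘L coordSnd)

lemma hypRot_deriv (z : ℂ) (X : StateSpace) :
    (hypRot z X).fst.deriv = mulL (coshI z) X.fst.deriv + mulL (sinhI z) X.snd :=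
  add_zero _

lemma hypRot_snd (z : ℂ) (X : StateSpace) :
    (hypRot z X).snd = mulL (sinhI z) X.fst.deriv + mulL (coshI z) X.snd :=
  zero_add _

/-- The addition theorems make the rotations a one-parameter group, so each is invertible with
inverse at `-z`. -/
lemma hypRot_hypRot (z w : ℂ) (X : StateSpace) : hypRot z (hypRot w X) = hypRot (z + w) X := by
  refine StateSpace.ext' ?_ ?_
  · simp only [hypRot_deriv, hypRot_snd, map_add, mulL_mulL, coshI_add, sinhI_add, mulL_add,
      add_apply]
    abel
  · simp only [hypRot_deriv, hypRot_snd, map_add, mulL_mulL, coshI_add, sinhI_add, mulL_add,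
      add_apply]
    abel

lemma hypRot_zero (X : StateSpace) : hypRot 0 X = X := by
  refine StateSpace.ext' ?_ ?_ <;>
    simp [hypRot_deriv, hypRot_snd, coshI_zero, sinhI_zero, mulL_zero, mulL_one]

/-- Rotations translate the parameter. One automorphism can therefore absorb the common real part of
all leading exponents. -/
lemma hypRot_expState (z w : ℂ) : hypRot z (expState w) = expState (z + w) := by
  refine StateSpace.ext' ?_ ?_
  · simp only [hypRot_deriv, expState_deriv, expState_snd, mulL_toL2, coshI_add, map_add]
  · simp only [hypRot_snd, expState_deriv, expState_snd, mulL_toL2, sinhI_add, map_add]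

/-- `hypRot z` as an automorphism of the state space. -/
noncomputable def hypRotEquiv (z : ℂ) : StateSpace ≃L[ℂ] StateSpace :=
  ContinuousLinearEquiv.equivOfInverse (hypRot z) (hypRot (-z))
    (fun X => by rw [hypRot_hypRot, neg_add_cancel, hypRot_zero])
    (fun X => by rw [hypRot_hypRot, add_neg_cancel, hypRot_zero])

lemma hypRotEquiv_expState (z w : ℂ) : hypRotEquiv z (expState w) = expState (z + w) :=
  hypRot_expState z w

end Multiplication

/-! ### An orthonormal basis of trigonometric states. -/

section FourierBasis

lemma integrable_of_continuous_unitInterval {f : I → ℂ} (hf : Continuous f) :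
    Integrable f (volume : Measure I) :=
  hf.integrable_of_hasCompactSupport (HasCompactSupport.of_compactSpace f)

/-- For imaginary parameters conjugation fixes `cosh` and changes the sign of `sinh`, so the
addition theorem merges the two integrands. Only the difference of the frequencies remains, which
makes both choices of `nShift` orthonormal. -/
lemma inner_expState_I (a b : ℝ) :
    inner ℂ (expState (a * Complex.I)) (expState (b * Complex.I)) =
      ∫ x in (0 : ℝ)..1, Complex.cosh ((b - a) * Complex.I * (x - 1)) := by
  rw [WithLp.prod_inner_apply]
  change inner ℂ (expState (a * Complex.I)).fst.deriv (expState (b * Complex.I)).fst.deriv +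
    inner ℂ (expState (a * Complex.I)).snd (expState (b * Complex.I)).snd = _
  simp only [expState_deriv, expState_snd, ContinuousMap.inner_toLp]
  rw [← integral_add (integrable_of_continuous_unitInterval (by fun_prop))
    (integrable_of_continuous_unitInterval (by fun_prop)), ← integral_unitInterval]
  refine integral_congr_ae (Eventually.of_forall fun x => ?_)
  simp only [coshI_apply, sinhI_apply, ← Complex.cosh_conj, ← Complex.sinh_conj]
  simp only [map_mul, map_sub, Complex.conj_ofReal, Complex.conj_I, map_one]
  have e : (a : ℂ) * -Complex.I * ((x : ℝ) - 1) = -(a * Complex.I * ((x : ℝ) - 1)) := by ring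
  rw [sub_mul, sub_mul, Complex.cosh_sub, e, Complex.cosh_neg, Complex.sinh_neg]
  ring

lemma integral_cosh_int_mul_pi_I (m : ℤ) :
    ∫ x in (0 : ℝ)..1, Complex.cosh (m * Real.pi * Complex.I * (x - 1)) =
      if m = 0 then 1 else 0 := by
  split_ifs with h
  · simp [h]
  · have hz : (m * Real.pi * Complex.I : ℂ) ≠ 0 := by
      simp [h, Real.pi_ne_zero]
    have hd : ∀ t : ℝ, HasDerivAt (fun x : ℝ => (m * Real.pi * Complex.I : ℂ)⁻¹ *
        Complex.sinh (m * Real.pi * Complex.I * (x - 1)))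
        (Complex.cosh (m * Real.pi * Complex.I * (t - 1))) t := fun t => by
      have := (hasDerivAt_sinh_mul_sub_one (m * Real.pi * Complex.I) t).const_mul
        (m * Real.pi * Complex.I : ℂ)⁻¹
      rwa [inv_mul_cancel_left₀ hz] at this
    rw [intervalIntegral.integral_eq_sub_of_hasDerivAt (fun t _ => hd t)
      ((by fun_prop : Continuous fun x : ℝ =>
        Complex.cosh (m * Real.pi * Complex.I * (x - 1))).intervalIntegrable _ _)]
    have : Complex.sinh (m * Real.pi * Complex.I : ℂ) = 0 := by
      rw [Complex.sinh_mul_I, Complex.sin_int_mul_pi, zero_mul]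
    simp [this]

/-- The frequency `θ_n = n_γ π`. -/
noncomputable def freq (γ : ℝ) (n : ℤ) : ℝ := nShift γ n * Real.pi

lemma freq_sub_freq (γ : ℝ) (m n : ℤ) : freq γ m - freq γ n = (m - n : ℤ) * Real.pi := by
  unfold freq nShift
  split_ifs <;> push_cast <;> ring

lemma orthonormal_expState_freq (γ : ℝ) :
    Orthonormal ℂ fun n : ℤ => expState (freq γ n * Complex.I) := by
  rw [orthonormal_iff_ite]
  intro i j
  rw [inner_expState_I]
  have : (freq γ j : ℂ) - freq γ i = (j - i : ℤ) * Real.pi := by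
    exact_mod_cast freq_sub_freq γ j i
  rw [this, integral_cosh_int_mul_pi_I]
  simp only [sub_eq_zero, eq_comm]

/-- A real-valued injective function generates a dense algebra of functions on `[0,1]`. -/
lemma topologicalClosure_adjoin_eq_top {κ : C(I, ℂ)} (hκ : star κ = κ)
    (hinj : Function.Injective κ) : (Algebra.adjoin ℂ {κ}).topologicalClosure = ⊤ := by
  have h1 := ContinuousMap.starSubalgebra_topologicalClosure_eq_top_of_separatesPoints
    (StarAlgebra.adjoin ℂ ({κ} : Set C(I, ℂ))) (fun x y hxy =>
      ⟨κ, ⟨κ, StarAlgebra.subset_adjoin ℂ _ rfl, rfl⟩, fun e => hxy (hinj e)⟩)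
  have h2 : (StarAlgebra.adjoin ℂ ({κ} : Set C(I, ℂ))).toSubalgebra = Algebra.adjoin ℂ {κ} := by
    rw [StarAlgebra.adjoin_toSubalgebra, Set.star_singleton, hκ, union_self]
  rw [← h2, ← StarSubalgebra.topologicalClosure_toSubalgebra_comm, h1,
    StarSubalgebra.top_toSubalgebra]

/-- If `(f', g)` is orthogonal to all `expState (i θ_n)`, it is so to all their multiples by
continuous functions. -/
lemma inner_mul_expState_eq_zero {γ : ℝ} {X : StateSpace}
    (hX : ∀ n : ℤ, inner ℂ (expState (freq γ n * Complex.I)) X = 0) (h : C(I, ℂ)) (n : ℤ) :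
    inner ℂ (toL2 (h * coshI (freq γ n * Complex.I))) X.fst.deriv +
      inner ℂ (toL2 (h * sinhI (freq γ n * Complex.I))) X.snd = 0 := by
  set Λ : ℤ → C(I, ℂ) → ℂ := fun n h =>
    inner ℂ (toL2 (h * coshI (freq γ n * Complex.I))) X.fst.deriv +
      inner ℂ (toL2 (h * sinhI (freq γ n * Complex.I))) X.snd with hΛ
  have hΛadd : ∀ n h k, Λ n (h + k) = Λ n h + Λ n k := fun n h k => by
    simp only [hΛ, add_mul, map_add, inner_add_left]; ring
  have hΛsmul : ∀ n (c : ℂ) h, Λ n (c • h) = star c * Λ n h := fun n c h => by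
    simp only [hΛ, smul_mul_assoc, map_smul, inner_smul_left, RCLike.star_def]; ring
  set κ : C(I, ℂ) := coshI (Real.pi * Complex.I) + coshI (Real.pi * Complex.I) with hκdef
  have hstep : ∀ n h, Λ n (κ * h) = Λ (n + 1) h + Λ (n - 1) h := fun n h => by
    have e1 : (freq γ (n + 1) * Complex.I : ℂ) = freq γ n * Complex.I + Real.pi * Complex.I := by
      have := freq_sub_freq γ (n + 1) n
      have h2 : freq γ (n + 1) = freq γ n + Real.pi := by
        rw [← sub_eq_iff_eq_add', this]; simp
      rw [h2]; push_cast; ring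
    have e2 : (freq γ (n - 1) * Complex.I : ℂ) = freq γ n * Complex.I + -(Real.pi * Complex.I) := by
      have := freq_sub_freq γ (n - 1) n
      have h2 : freq γ (n - 1) = freq γ n - Real.pi := by
        rw [sub_eq_iff_eq_add'] at this
        rw [this]; push_cast; ring
      rw [h2]; push_cast; ring
    have c1 : κ * h * coshI (freq γ n * Complex.I) = h * coshI (freq γ (n + 1) * Complex.I) +
        h * coshI (freq γ (n - 1) * Complex.I) := by
      rw [e1, e2, coshI_add, coshI_add, coshI_neg, sinhI_neg, hκdef]; ring
    have c2 : κ * h * sinhI (freq γ n * Complex.I) = h * sinhI (freq γ (n + 1) * Complex.I) +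
        h * sinhI (freq γ (n - 1) * Complex.I) := by
      rw [e1, e2, sinhI_add, sinhI_add, coshI_neg, sinhI_neg, hκdef]; ring
    simp only [hΛ, c1, c2, map_add, inner_add_left]
    ring
  -- The multipliers preserving orthogonality at all frequencies form an algebra containing `κ`.
  -- Since `κ` is real and injective, Stone–Weierstrass makes the algebra it generates dense.
  let N : Subalgebra ℂ C(I, ℂ) :=
    { carrier := {k | ∀ h, (∀ n, Λ n h = 0) → ∀ n, Λ n (k * h) = 0}
      mul_mem' := fun {a b} ha hb h hh n => by
        rw [mul_assoc]; exact ha _ (hb h hh) n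
      add_mem' := fun {a b} ha hb h hh n => by
        rw [add_mul, hΛadd, ha h hh, hb h hh, add_zero]
      algebraMap_mem' := fun c h hh n => by
        rw [← Algebra.smul_def, hΛsmul, hh, mul_zero] }
  have hκN : Algebra.adjoin ℂ {κ} ≤ N := by
    refine Algebra.adjoin_le ?_
    rw [singleton_subset_iff]
    intro h hh n
    rw [hstep, hh, hh, add_zero]
  have hcos : ∀ x : I, κ x = ((2 * Real.cos (Real.pi * (1 - x)) : ℝ) : ℂ) := fun x => by
    simp only [hκdef, ContinuousMap.add_apply, coshI_apply]
    have : (Real.pi * Complex.I * ((x : ℝ) - 1) : ℂ) = -((Real.pi * (1 - x) : ℝ) * Complex.I) := by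
      push_cast; ring
    rw [this, Complex.cosh_neg, Complex.cosh_mul_I]
    push_cast; ring
  have htop := topologicalClosure_adjoin_eq_top (κ := κ)
    (by ext x; rw [ContinuousMap.star_apply, hcos, RCLike.star_def, Complex.conj_ofReal])
    (fun x y hxy => by
      rw [hcos, hcos] at hxy
      have h1 : Real.cos (Real.pi * (1 - x)) = Real.cos (Real.pi * (1 - y)) := by
        have := Complex.ofReal_injective hxy
        linarith
      have hm : ∀ x : I, Real.pi * (1 - x) ∈ Icc 0 Real.pi := fun x =>
        ⟨mul_nonneg Real.pi_pos.le (sub_nonneg.2 x.2.2),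
          mul_le_of_le_one_right Real.pi_pos.le (by linarith [x.2.1])⟩
      have h2 := mul_left_cancel₀ Real.pi_ne_zero (Real.injOn_cos (hm x) (hm y) h1)
      exact Subtype.ext (by linarith))
  have hcl : IsClosed {k : C(I, ℂ) | Λ n k = 0} := by
    refine isClosed_eq ?_ continuous_const
    simp only [hΛ]
    fun_prop
  have h1 : ∀ n, Λ n 1 = 0 := fun n => by
    simp only [hΛ, one_mul, ← expState_deriv, ← expState_snd]
    exact hX n
  have hsub : ((Algebra.adjoin ℂ {κ}).topologicalClosure : Set C(I, ℂ)) ⊆ {k | Λ n k = 0} :=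
    closure_minimal (fun k hk => by simpa using hκN hk 1 h1 n) hcl
  rw [htop] at hsub
  exact hsub (mem_univ h)

lemma sinhI_pi_I_ne_zero : ∀ᵐ x : I, sinhI (Real.pi * Complex.I) x ≠ 0 := by
  have h0 : ∀ᵐ x : I, x ≠ 0 := by
    simp [ae_iff]
  have h1 : ∀ᵐ x : I, x ≠ 1 := by
    simp [ae_iff]
  filter_upwards [h0, h1] with x hx0 hx1
  have hx0' : 0 < (x : ℝ) := unitInterval.pos_iff_ne_zero.2 hx0
  have hx1' : (x : ℝ) < 1 := unitInterval.lt_one_iff_ne_one.2 hx1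
  have e : (Real.pi * Complex.I * ((x : ℝ) - 1) : ℂ) = -((Real.pi * (1 - x) : ℝ) * Complex.I) := by
    push_cast; ring
  rw [sinhI_apply, e, Complex.sinh_neg, Complex.sinh_mul_I, ← Complex.ofReal_sin]
  have : 0 < Real.sin (Real.pi * (1 - x)) := Real.sin_pos_of_pos_of_lt_pi
    (mul_pos Real.pi_pos (by linarith)) (by nlinarith [Real.pi_pos])
  exact neg_ne_zero.2 (mul_ne_zero (Complex.ofReal_ne_zero.2 this.ne') Complex.I_ne_zero)

/-- Orthogonality at two consecutive frequencies, with arbitrary continuous multipliers, is a linear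
system for `(f', g)` with determinant `sinhI (π i)` up to sign. It is nonzero almost everywhere, and
Cramer's rule makes both components vanish. -/
lemma eq_zero_of_forall_inner_expState {γ : ℝ} {X : StateSpace}
    (hX : ∀ n : ℤ, inner ℂ (expState (freq γ n * Complex.I)) X = 0) : X = 0 := by
  have key := inner_mul_expState_eq_zero hX
  have e1 : (freq γ 1 * Complex.I : ℂ) = freq γ 0 * Complex.I + Real.pi * Complex.I := by
    have h2 : freq γ 1 = freq γ 0 + Real.pi := by
      rw [← sub_eq_iff_eq_add', freq_sub_freq]; simp
    rw [h2]; push_cast; ring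
  have hD : sinhI (Real.pi * Complex.I) =
      sinhI (freq γ 1 * Complex.I) * coshI (freq γ 0 * Complex.I) -
        coshI (freq γ 1 * Complex.I) * sinhI (freq γ 0 * Complex.I) := by
    have : (Real.pi * Complex.I : ℂ) = freq γ 1 * Complex.I + -(freq γ 0 * Complex.I) := by
      rw [e1]; ring
    rw [this, sinhI_add, coshI_neg, sinhI_neg]
    ring
  refine StateSpace.ext' (L2.eq_zero_of_forall_inner_toL2_mul sinhI_pi_I_ne_zero fun k => ?_)
    (L2.eq_zero_of_forall_inner_toL2_mul sinhI_pi_I_ne_zero fun k => ?_)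
  · have k1 := key (k * sinhI (freq γ 1 * Complex.I)) 0
    have k2 := key (k * sinhI (freq γ 0 * Complex.I)) 1
    have : k * sinhI (Real.pi * Complex.I) =
        k * sinhI (freq γ 1 * Complex.I) * coshI (freq γ 0 * Complex.I) -
          k * sinhI (freq γ 0 * Complex.I) * coshI (freq γ 1 * Complex.I) := by
      rw [hD]; ring
    rw [this, map_sub, inner_sub_left]
    rw [mul_right_comm k (sinhI (freq γ 0 * Complex.I)) (sinhI (freq γ 1 * Complex.I))] at k2
    linear_combination k1 - k2
  · have k1 := key (k * coshI (freq γ 1 * Complex.I)) 0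
    have k2 := key (k * coshI (freq γ 0 * Complex.I)) 1
    have : k * sinhI (Real.pi * Complex.I) =
        k * coshI (freq γ 0 * Complex.I) * sinhI (freq γ 1 * Complex.I) -
          k * coshI (freq γ 1 * Complex.I) * sinhI (freq γ 0 * Complex.I) := by
      rw [hD]; ring
    rw [this, map_sub, inner_sub_left]
    rw [mul_right_comm k (coshI (freq γ 0 * Complex.I)) (coshI (freq γ 1 * Complex.I))] at k2
    linear_combination k2 - k1

/-- The orthonormal basis `(f', g) = (cos θ_n(x-1), i sin θ_n(x-1))` of the state space. -/
noncomputable def fourierState (γ : ℝ) : HilbertBasis ℤ ℂ StateSpace :=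
  HilbertBasis.mkOfOrthogonalEqBot (orthonormal_expState_freq γ) <| by
    rw [Submodule.eq_bot_iff]
    intro X hX
    refine eq_zero_of_forall_inner_expState (γ := γ) fun n => ?_
    exact (Submodule.mem_orthogonal _ _).1 hX _ (Submodule.subset_span ⟨n, rfl⟩)

lemma fourierState_apply (γ : ℝ) (n : ℤ) :
    fourierState γ n = expState (freq γ n * Complex.I) := by
  rw [fourierState, HilbertBasis.coe_mkOfOrthogonalEqBot]

end FourierBasis

/-! ### The unperturbed Riesz basis and density of the domain. -/

section DenseRange

lemma HilbertBasis.denseRange_of_forall_mem_closure {ι H : Type*} [NormedAddCommGroup H]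
    [InnerProductSpace ℂ H] (b : HilbertBasis ι ℂ H) (S : H ≃L[ℂ] H) {R : H →L[ℂ] H}
    (h : ∀ n, S (b n) ∈ closure (range R)) : DenseRange R := by
  have hVc : IsClosed ((LinearMap.range R.toLinearMap).topologicalClosure : Set H) :=
    Submodule.isClosed_topologicalClosure _
  have h1 : Submodule.span ℂ (range b) ≤
      (LinearMap.range R.toLinearMap).topologicalClosure.comap (S : H →L[ℂ] H).toLinearMap := by
    rw [Submodule.span_le]
    rintro _ ⟨n, rfl⟩
    exact h n
  have h2 := Submodule.topologicalClosure_minimal _ h1 (hVc.preimage S.continuous)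
  rw [b.dense_span] at h2
  intro x
  have h3 := h2 (Submodule.mem_top (x := S.symm x))
  rw [Submodule.mem_comap] at h3
  have h4 : (S : H →L[ℂ] H).toLinearMap (S.symm x) = x := S.apply_symm_apply x
  rw [h4] at h3
  exact h3

/-- The function `x ↦ (1 - x)^(k+1)`. -/
noncomputable def oneSubPow (k : ℕ) : C(I, ℂ) :=
  restrI (fun x => (1 - x : ℂ) ^ (k + 1)) (by fun_prop)

/-- The derivative of `x ↦ (1 - x)^(k+1)`. -/
noncomputable def oneSubPowDeriv (k : ℕ) : C(I, ℂ) :=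
  restrI (fun x => -((k + 1 : ℕ) * (1 - x : ℂ) ^ k)) (by fun_prop)

lemma inclFst_oneSubPowDeriv_fn (k : ℕ) (x : I) :
    (inclFst (toL2 (oneSubPowDeriv k))).fst.fn x = (1 - (x : ℝ) : ℂ) ^ (k + 1) :=
  fn_eq_of_deriv_eq_restrI (f := fun x => (1 - x : ℂ) ^ (k + 1))
    (fun t => by
      have h := ((Complex.ofRealCLM.hasDerivAt (x := t)).const_sub 1).fun_pow (k + 1)
      simpa using h) (by fun_prop) (by simp) rfl x

lemma norm_toL2_oneSubPow (k : ℕ) : ‖toL2 (oneSubPow k)‖ ^ 2 = 1 / (2 * k + 3) := by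
  have h1 : inner ℂ (toL2 (oneSubPow k)) (toL2 (oneSubPow k)) = ((1 / (2 * k + 3) : ℝ) : ℂ) := by
    rw [ContinuousMap.inner_toLp]
    have : ∀ x : I, oneSubPow k x * (starRingEnd ℂ) (oneSubPow k x) =
        (((1 - (x : ℝ)) ^ (2 * k + 2) : ℝ) : ℂ) := fun x => by
      have : oneSubPow k x = (((1 - (x : ℝ)) ^ (k + 1) : ℝ) : ℂ) := by
        simp [oneSubPow]
      rw [this, Complex.conj_ofReal]
      push_cast
      ring
    simp only [this]
    rw [integral_unitInterval fun x => (((1 - x) ^ (2 * k + 2) : ℝ) : ℂ),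
      intervalIntegral.integral_ofReal,
      intervalIntegral.integral_comp_sub_left (fun x => x ^ (2 * k + 2)), integral_pow]
    congr 1
    push_cast
    norm_num
    ring
  have h2 := inner_self_eq_norm_sq_to_K (𝕜 := ℂ) (toL2 (oneSubPow k))
  rw [h1] at h2
  refine Complex.ofReal_injective (Eq.trans ?_ h2.symm)
  simp

/-- These functions vanish at `1` and equal `1` at `0`, yet tend to zero in `L²`. They can repair a
boundary condition at `0` at arbitrarily small cost. -/
lemma tendsto_toL2_oneSubPow : Tendsto (fun k => toL2 (oneSubPow k)) atTop (nhds 0) := by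
  rw [tendsto_zero_iff_norm_tendsto_zero]
  have h1 : Tendsto (fun k : ℕ => ‖toL2 (oneSubPow k)‖ ^ 2) atTop (nhds 0) := by
    simp only [norm_toL2_oneSubPow]
    refine tendsto_const_nhds.div_atTop ?_
    exact tendsto_atTop_add_const_right _ _
      (tendsto_natCast_atTop_atTop.const_mul_atTop (by norm_num))
  have h2 := h1.sqrt
  simpa [Real.sqrt_sq] using h2

variable {γ β : ℝ}

/-- The eigenvectors of the unperturbed operator `β = 0` lie in the closure of the domain. -/
lemma expState_mem_closure_range_waveInv (hγ : 0 < γ) (hβ : 0 < β) {z : ℂ}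
    (hz : Complex.cosh z + γ * Complex.sinh z = 0) :
    expState z ∈ closure (range (waveInv γ β)) := by
  have hz0 : z ≠ 0 := by rintro rfl; simp at hz
  -- `expState z` satisfies the boundary condition for `β = 0` and misses the true one by `β f(0) =
  -- -β z⁻¹ sinh z`. Adding `s` to `g(0)` contributes `γ s`, which cancels this defect.
  set s : ℂ := β * (z⁻¹ * Complex.sinh z) / γ with hs
  have hlim : Tendsto (fun k => expState z + s • inclSnd (toL2 (oneSubPow k))) atTop
      (nhds (expState z)) := by
    have := ((inclSnd.continuous.tendsto 0).comp tendsto_toL2_oneSubPow).const_smul s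
    simpa using this.const_add (expState z)
  refine mem_closure_of_tendsto hlim (Eventually.of_forall fun k => ?_)
  refine ⟨z • expState z + s • inclFst (toL2 (oneSubPowDeriv k)), ((mem_waveGraph_iff hβ _ _).1 ?_).symm⟩
  have hfn : (z • expState z + s • inclFst (toL2 (oneSubPowDeriv k))).fst.fn =
      sinhI z + s • oneSubPow k := by
    ext x
    change z * (expState z).fst.fn x + s * (inclFst (toL2 (oneSubPowDeriv k))).fst.fn x = _
    rw [expState_fn hz0, mul_inv_cancel_left₀ hz0, inclFst_oneSubPowDeriv_fn]
    rfl
  refine ⟨?_, (coshI z, toL2 (z • sinhI z)),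
    restrI_mem_H1 (hasDerivAt_cosh_mul_sub_one z) (by fun_prop) _, ?_, ?_, ?_⟩
  · rw [hfn]
    change _ = (expState z).snd + s • toL2 (oneSubPow k)
    rw [expState_snd, map_add, map_smul]
  · change _ = (expState z).fst.deriv + s • (0 : H1e).deriv
    rw [expState_deriv, map_zero, smul_zero, add_zero]
  · change _ = z • (expState z).snd + s • (0 : L2)
    rw [expState_snd, map_smul, smul_zero, add_zero]
  · have h0 : (expState z + s • inclSnd (toL2 (oneSubPow k))).fst.fn 0 =
        z⁻¹ * sinhFn z (0 : I) := by
      rw [← expState_fn hz0]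
      change (expState z).fst.fn 0 + s * H1e.fn (0 : H1e) 0 = _
      rw [map_zero H1e.fn, ContinuousMap.zero_apply, mul_zero, add_zero]
    have hγ' : (γ : ℂ) ≠ 0 := by exact_mod_cast hγ.ne'
    simp only [hfn, h0]
    simp only [coshI_apply, sinhI_apply, sinhFn, ContinuousMap.add_apply,
      ContinuousMap.smul_apply, oneSubPow, restrI_apply]
    simp only [Set.Icc.coe_zero, Complex.ofReal_zero, zero_sub, mul_neg, mul_one, Complex.cosh_neg,
      Complex.sinh_neg, sub_zero, one_pow, smul_eq_mul, hs]
    field_simp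
    linear_combination z * hz

/-- The leading term `½ ln |(γ-1)/(γ+1)| + i n_γ π` of the eigenvalues. -/
noncomputable def leadExp (γ : ℝ) (n : ℤ) : ℂ :=
  ((1 / 2 * Real.log |(γ - 1) / (γ + 1)| : ℝ) : ℂ) + nShift γ n * Real.pi * Complex.I

lemma leadExp_eq (γ : ℝ) (n : ℤ) : leadExp γ n =
    ((1 / 2 * Real.log |(γ - 1) / (γ + 1)| : ℝ) : ℂ) + freq γ n * Complex.I := by
  rw [leadExp, freq]; push_cast; ring

/-- The shift in `nShift` supplies the sign: the quotient is negative for `γ < 1`, where the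
half-integer contributes `-1`, and positive for `γ > 1`. -/
lemma exp_two_mul_leadExp (hγ : 0 < γ) (hγ1 : γ ≠ 1) (n : ℤ) :
    Complex.exp (2 * leadExp γ n) = (((γ - 1) / (γ + 1) : ℝ) : ℂ) := by
  have hr : (γ - 1) / (γ + 1) ≠ 0 := div_ne_zero (sub_ne_zero.2 hγ1) (by positivity)
  have h1 : Complex.exp (((Real.log |(γ - 1) / (γ + 1)| : ℝ)) : ℂ) = (|(γ - 1) / (γ + 1)| : ℝ) := by
    rw [← Complex.ofReal_exp, Real.exp_log (abs_pos.2 hr)]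
  have h2 : 2 * leadExp γ n = ((Real.log |(γ - 1) / (γ + 1)| : ℝ) : ℂ) +
      2 * nShift γ n * Real.pi * Complex.I := by
    rw [leadExp]; push_cast; ring
  rw [h2, Complex.exp_add, h1]
  unfold nShift
  split_ifs with h
  · have : (2 * ((n : ℝ) - 1 / 2 : ℝ) * Real.pi * Complex.I : ℂ) =
        n * (2 * Real.pi * Complex.I) - Real.pi * Complex.I := by push_cast; ring
    rw [this, Complex.exp_sub, Complex.exp_int_mul_two_pi_mul_I, Complex.exp_pi_mul_I,
      abs_of_neg (div_neg_of_neg_of_pos (by linarith) (by positivity))]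
    push_cast
    ring
  · have hlt : 1 < γ := lt_of_le_of_ne (not_lt.1 h) hγ1.symm
    have : (2 * ((n : ℝ) : ℝ) * Real.pi * Complex.I : ℂ) = n * (2 * Real.pi * Complex.I) := by
      push_cast; ring
    rw [this, Complex.exp_int_mul_two_pi_mul_I,
      abs_of_pos (div_pos (by linarith) (by positivity)), mul_one]

/-- Multiplied by `2 e^z`, the equation `cosh z + γ sinh z = 0` reads `(γ + 1) e^{2z} = γ - 1`. -/
lemma cosh_leadExp_add (hγ : 0 < γ) (hγ1 : γ ≠ 1) (n : ℤ) :
    Complex.cosh (leadExp γ n) + γ * Complex.sinh (leadExp γ n) = 0 := by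
  have h := exp_two_mul_leadExp hγ hγ1 n
  have h1 : (γ + 1 : ℂ) ≠ 0 := by exact_mod_cast (by positivity : γ + 1 ≠ 0)
  push_cast at h
  rw [two_mul, Complex.exp_add, eq_div_iff h1] at h
  have h2 : Complex.exp (leadExp γ n) * Complex.exp (-leadExp γ n) = 1 := by
    rw [← Complex.exp_add, add_neg_cancel, Complex.exp_zero]
  rw [Complex.cosh, Complex.sinh]
  linear_combination (Complex.exp (-leadExp γ n) / 2) * h -
    Complex.exp (leadExp γ n) * (γ + 1) / 2 * h2

/-- The Riesz basis of eigenvectors of the unperturbed operator, as a map from the orthonormal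
basis. -/
noncomputable def leadEquiv (γ : ℝ) : StateSpace ≃L[ℂ] StateSpace :=
  hypRotEquiv ((1 / 2 * Real.log |(γ - 1) / (γ + 1)| : ℝ) : ℂ)

lemma leadEquiv_fourierState (γ : ℝ) (n : ℤ) :
    leadEquiv γ (fourierState γ n) = expState (leadExp γ n) := by
  rw [leadEquiv, fourierState_apply, hypRotEquiv_expState, leadExp_eq]

lemma denseRange_waveInv (hγ : 0 < γ) (hγ1 : γ ≠ 1) (hβ : 0 < β) : DenseRange (waveInv γ β) :=
  (fourierState γ).denseRange_of_forall_mem_closure (leadEquiv γ) fun n => by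
    rw [leadEquiv_fourierState]
    exact expState_mem_closure_range_waveInv hγ hβ (cosh_leadExp_add hγ hγ1 n)

end DenseRange

/-! ### Roots of the characteristic equation and asymptotics of the eigenvectors. -/

section Asymptotics

variable {γ β : ℝ}

lemma abs_le_norm_leadExp (γ : ℝ) (n : ℤ) : |(n : ℝ)| ≤ ‖leadExp γ n‖ := by
  have h1 : |freq γ n| ≤ ‖leadExp γ n‖ := by
    have h := Complex.abs_im_le_norm (leadExp γ n)
    have e : (leadExp γ n).im = freq γ n := by rw [leadExp_eq]; simp
    rwa [e] at h
  have h2 : |(n : ℝ)| ≤ |nShift γ n| * 2 := by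
    unfold nShift
    split_ifs
    · rcases lt_trichotomy n 0 with h | h | h
      · have : (n : ℝ) < 0 := by exact_mod_cast h
        rw [abs_of_neg this, abs_of_neg (by linarith)]
        linarith
      · simp [h]
      · have : (1 : ℝ) ≤ n := by exact_mod_cast h
        rw [abs_of_nonneg (by linarith), abs_of_nonneg (by linarith)]
        linarith
    · linarith [abs_nonneg (n : ℝ)]
  refine (h2.trans ?_).trans h1
  rw [freq, abs_mul, abs_of_pos Real.pi_pos]
  gcongr
  exact Real.two_le_pi

lemma tendsto_inv_abs_int : Tendsto (fun n : ℤ => |(n : ℝ)|⁻¹) cofinite (nhds 0) := by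
  refine tendsto_inv_atTop_zero.comp ?_
  have := tendsto_norm_cocompact_atTop.comp Int.tendsto_coe_cofinite
  exact this

/-- The characteristic equation of the wave operator. -/
def IsCharRoot (γ β : ℝ) (z : ℂ) : Prop :=
  z * Complex.cosh z + (γ * z + β) * Complex.sinh z = 0

/-- The inverse of the leading exponent as a function of the correction to it. -/
noncomputable def invLead (γ β : ℝ) (w : ℂ) : ℂ :=
  (γ ^ 2 - 1) * (1 - Complex.exp (2 * w)) /
    ((γ - 1) * Complex.exp (2 * w) * ((γ + 1) * w + β) - (γ + 1) * ((γ - 1) * w + β))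

/-- In exponential form the equation is `e^{2z} ((γ + 1) z + β) = (γ - 1) z + β`. For `z = μ + w`
with `e^{2μ}` known it is affine in `μ`, and solving for `μ⁻¹` gives `invLead γ β w`. Large roots
thus become an inversion problem near `w = 0`. -/
lemma isCharRoot_of_invLead (hγ : 0 < γ) {μ w : ℂ} (hμ : μ ≠ 0)
    (hexp : Complex.exp (2 * μ) = (((γ - 1) / (γ + 1) : ℝ) : ℂ))
    (h : invLead γ β w = μ⁻¹) : IsCharRoot γ β (μ + w) := by
  have hγ' : (γ + 1 : ℂ) ≠ 0 := by exact_mod_cast (by positivity : γ + 1 ≠ 0)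
  set N : ℂ := (γ - 1) * Complex.exp (2 * w) * ((γ + 1) * w + β) - (γ + 1) * ((γ - 1) * w + β)
    with hN
  -- A zero denominator would make the quotient `0` by convention, whereas `μ⁻¹ ≠ 0`.
  have hN0 : N ≠ 0 := by
    intro h0
    rw [invLead, ← hN, h0, div_zero] at h
    exact inv_ne_zero hμ h.symm
  rw [invLead, ← hN, div_eq_iff hN0, eq_comm, inv_mul_eq_iff_eq_mul₀ hμ, hN] at h
  have h1 : Complex.exp (2 * (μ + w)) * (γ + 1) = (γ - 1) * Complex.exp (2 * w) := by
    rw [show 2 * (μ + w) = 2 * μ + 2 * w by ring, Complex.exp_add, hexp]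
    push_cast
    field_simp
  have h2 : Complex.exp (2 * (μ + w)) * ((γ + 1) * (μ + w) + β) = (γ - 1) * (μ + w) + β := by
    refine mul_right_cancel₀ hγ' ?_
    linear_combination ((γ + 1) * (μ + w) + β) * h1 + h
  have h3 : Complex.exp (2 * (μ + w)) * Complex.exp (-(μ + w)) = Complex.exp (μ + w) := by
    rw [← Complex.exp_add]; congr 1; ring
  rw [IsCharRoot, Complex.cosh, Complex.sinh]
  linear_combination Complex.exp (-(μ + w)) / 2 * h2 -
    ((γ + 1) * (μ + w) + β) / 2 * h3

/-- The denominator equals `-2 β` at `0`, so `β ≠ 0` gives differentiability; the derivative is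
nonzero when moreover `γ² ≠ 1`. -/
lemma hasStrictDerivAt_invLead (hβ : 0 < β) :
    HasStrictDerivAt (invLead γ β) (((γ ^ 2 - 1) / β : ℝ) : ℂ) 0 := by
  have hβ' : (β : ℂ) ≠ 0 := by exact_mod_cast hβ.ne'
  have he : HasStrictDerivAt (fun w : ℂ => Complex.exp (2 * w)) 2 0 := by
    simpa using ((hasStrictDerivAt_id (0 : ℂ)).const_mul 2).cexp
  have hl : ∀ a : ℂ, HasStrictDerivAt (fun w : ℂ => a * w + β) a 0 := fun a => by
    simpa using ((hasStrictDerivAt_id (0 : ℂ)).const_mul a).add_const (β : ℂ)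
  have hn := (he.const_sub 1).const_mul ((γ : ℂ) ^ 2 - 1)
  have hd := ((he.const_mul ((γ : ℂ) - 1)).mul (hl (γ + 1))).sub
    ((hl (γ - 1)).const_mul ((γ : ℂ) + 1))
  refine (hn.div hd ?_).congr_deriv ?_
  · simp only [Pi.sub_apply, Pi.mul_apply, mul_zero, Complex.exp_zero, mul_one, zero_add]
    have : ((γ : ℂ) - 1) * β - (γ + 1) * β = -2 * β := by ring
    rw [this]
    exact mul_ne_zero (by norm_num) hβ'
  · simp only [Pi.sub_apply, Pi.mul_apply, mul_zero, Complex.exp_zero, mul_one, zero_add]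
    have : ((γ : ℂ) - 1) * β - (γ + 1) * β = -2 * β := by ring
    rw [this]
    push_cast
    field_simp
    ring

lemma inv_leadExp_isBigO (γ : ℝ) :
    (fun n => (leadExp γ n)⁻¹) =O[cofinite] fun n : ℤ => |(n : ℝ)|⁻¹ := by
  refine IsBigO.of_bound 1 ?_
  filter_upwards [(finite_singleton (0 : ℤ)).compl_mem_cofinite] with n hn
  have hn' : (0 : ℝ) < |(n : ℝ)| := abs_pos.2 (by exact_mod_cast hn)
  rw [one_mul, norm_inv, norm_inv, Real.norm_eq_abs, abs_abs]
  exact inv_anti₀ hn' (abs_le_norm_leadExp γ n)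

/-- Roots of the characteristic equation near the leading exponents. -/
lemma exists_isCharRoot (hγ : 0 < γ) (hγ1 : γ ≠ 1) (hβ : 0 < β) : ∃ z : ℤ → ℂ,
    ((fun n => z n - leadExp γ n) =O[cofinite] fun n : ℤ => |(n : ℝ)|⁻¹) ∧
    (∀ᶠ n in cofinite, z n ≠ 0 ∧ IsCharRoot γ β (z n)) ∧
    Tendsto (fun n => (z n)⁻¹) cofinite (nhds 0) := by
  have h' : (((γ ^ 2 - 1) / β : ℝ) : ℂ) ≠ 0 := by
    rw [Complex.ofReal_ne_zero]
    refine div_ne_zero (fun h => ?_) hβ.ne'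
    have : (γ - 1) * (γ + 1) = 0 := by linarith
    rcases mul_eq_zero.1 this with h | h
    · exact hγ1 (by linarith)
    · linarith
  have hd := hasStrictDerivAt_invLead (γ := γ) hβ
  have h0 : invLead γ β 0 = 0 := by simp [invLead]
  -- The correction to `leadExp γ n` is `g` evaluated at its inverse. As `g` is differentiable with
  -- `g 0 = 0`, the correction has the order of the inverse, that is, `1/|n|`.
  set g := hd.localInverse _ _ _ h' with hg
  have hgd : HasStrictDerivAt g _ 0 := h0 ▸ hd.to_localInverse h'
  have hgr : ∀ᶠ ε in nhds 0, invLead γ β (g ε) = ε := by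
    have := hd.eventually_right_inverse h'
    rwa [h0] at this
  have hg0 : g 0 = 0 := by
    have := (hd.eventually_left_inverse h').self_of_nhds
    rwa [h0] at this
  have hgO : g =O[nhds 0] fun ε => ε := by
    have := hgd.hasDerivAt.isBigO_sub
    simpa [hg0] using this
  have hlead := inv_leadExp_isBigO γ
  have hlim : Tendsto (fun n => (leadExp γ n)⁻¹) cofinite (nhds 0) :=
    hlead.trans_tendsto tendsto_inv_abs_int
  have hw : (fun n => g (leadExp γ n)⁻¹) =O[cofinite] fun n : ℤ => |(n : ℝ)|⁻¹ :=
    (hgO.comp_tendsto hlim).trans hlead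
  have hwlim : Tendsto (fun n => g (leadExp γ n)⁻¹) cofinite (nhds 0) :=
    hw.trans_tendsto tendsto_inv_abs_int
  have hne : ∀ᶠ n : ℤ in cofinite, leadExp γ n ≠ 0 := by
    filter_upwards [(finite_singleton (0 : ℤ)).compl_mem_cofinite] with n hn
    have hn' : (0 : ℝ) < |(n : ℝ)| := abs_pos.2 (by exact_mod_cast hn)
    exact norm_pos_iff.1 (hn'.trans_le (abs_le_norm_leadExp γ n))
  have hnorm : Tendsto (fun n => ‖leadExp γ n + g (leadExp γ n)⁻¹‖) cofinite atTop := by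
    have h1 : Tendsto (fun n => ‖leadExp γ n‖) cofinite atTop :=
      tendsto_atTop_mono (abs_le_norm_leadExp γ)
        (tendsto_norm_cocompact_atTop.comp Int.tendsto_coe_cofinite)
    have h2 : ∀ᶠ n in cofinite, ‖g (leadExp γ n)⁻¹‖ ≤ 1 :=
      (tendsto_zero_iff_norm_tendsto_zero.1 hwlim).eventually_le_const one_pos
    refine tendsto_atTop_mono' _ ?_ (tendsto_atTop_add_const_right _ (-1) h1)
    filter_upwards [h2] with n hn
    have := norm_sub_le (leadExp γ n + g (leadExp γ n)⁻¹) (g (leadExp γ n)⁻¹)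
    rw [add_sub_cancel_right] at this
    linarith
  refine ⟨fun n => leadExp γ n + g (leadExp γ n)⁻¹, by simpa using hw, ?_, ?_⟩
  · filter_upwards [hne, hlim.eventually hgr, hnorm.eventually_gt_atTop 0] with n h1 h2 h3
    exact ⟨norm_pos_iff.1 h3,
      isCharRoot_of_invLead hγ h1 (exp_two_mul_leadExp hγ hγ1 n) h2⟩
  · rw [tendsto_zero_iff_norm_tendsto_zero]
    simp only [norm_inv]
    exact tendsto_inv_atTop_zero.comp hnorm

lemma norm_exp_mul_sub_exp_mul_le {z w : ℂ} {A t : ℝ} (ht : |t| ≤ 1) (hw : |w.re| ≤ A)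
    (hzw : ‖z - w‖ ≤ 1) :
    ‖Complex.exp (z * t) - Complex.exp (w * t)‖ ≤ 2 * Real.exp A * ‖z - w‖ := by
  have h1 : Complex.exp (z * t) - Complex.exp (w * t) =
      Complex.exp (w * t) * (Complex.exp ((z - w) * t) - 1) := by
    rw [mul_sub, ← Complex.exp_add, mul_one]
    congr 2; ring
  have h2 : ‖Complex.exp (w * t)‖ ≤ Real.exp A := by
    rw [Complex.norm_exp, Complex.re_mul_ofReal]
    refine Real.exp_le_exp.2 ((le_abs_self _).trans ?_)
    rw [abs_mul]
    exact (mul_le_of_le_one_right (abs_nonneg _) ht).trans hw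
  have h3 : ‖(z - w) * t‖ ≤ ‖z - w‖ := by
    rw [norm_mul, Complex.norm_real]
    exact mul_le_of_le_one_right (norm_nonneg _) ht
  have h4 := Complex.norm_exp_sub_one_le (h3.trans hzw)
  rw [h1, norm_mul]
  calc _ ≤ Real.exp A * (2 * ‖z - w‖) := by
        gcongr
        exact h4.trans (by gcongr)
    _ = _ := by ring

lemma norm_coshI_sub_le {z w : ℂ} {A : ℝ} (hw : |w.re| ≤ A) (hzw : ‖z - w‖ ≤ 1) :
    ‖coshI z - coshI w‖ ≤ 2 * Real.exp A * ‖z - w‖ ∧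
      ‖sinhI z - sinhI w‖ ≤ 2 * Real.exp A * ‖z - w‖ := by
  have key : ∀ x : I, ‖Complex.exp (z * ((x : ℝ) - 1)) - Complex.exp (w * ((x : ℝ) - 1))‖ ≤
        2 * Real.exp A * ‖z - w‖ ∧
      ‖Complex.exp (-(z * ((x : ℝ) - 1))) - Complex.exp (-(w * ((x : ℝ) - 1)))‖ ≤
        2 * Real.exp A * ‖z - w‖ := fun x => by
    have hx : |(x : ℝ) - 1| ≤ 1 := by
      rw [abs_le]; constructor <;> linarith [x.2.1, x.2.2]
    have hx' : |1 - (x : ℝ)| ≤ 1 := by rwa [abs_sub_comm]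
    refine ⟨by simpa using norm_exp_mul_sub_exp_mul_le hx hw hzw, ?_⟩
    have := norm_exp_mul_sub_exp_mul_le hx' hw hzw
    push_cast at this
    rwa [show (1 - (x : ℝ) : ℂ) = -((x : ℝ) - 1) by ring, mul_neg, mul_neg] at this
  constructor
  · rw [ContinuousMap.norm_le _ (by positivity)]
    intro x
    obtain ⟨h1, h2⟩ := key x
    rw [ContinuousMap.sub_apply, coshI_apply, coshI_apply, Complex.cosh, Complex.cosh, ← sub_div,
      add_sub_add_comm, norm_div]
    have := norm_add_le_of_le h1 h2
    rw [div_le_iff₀ (by simp)]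
    refine this.trans (le_of_eq ?_)
    simp; ring
  · rw [ContinuousMap.norm_le _ (by positivity)]
    intro x
    obtain ⟨h1, h2⟩ := key x
    rw [ContinuousMap.sub_apply, sinhI_apply, sinhI_apply, Complex.sinh, Complex.sinh, ← sub_div,
      sub_sub_sub_comm, norm_div]
    have := norm_sub_le_of_le h1 h2
    rw [div_le_iff₀ (by simp)]
    refine this.trans (le_of_eq ?_)
    simp; ring

lemma isBigO_coshI_sub_leadExp {z : ℤ → ℂ}
    (hz : (fun n => z n - leadExp γ n) =O[cofinite] fun n : ℤ => |(n : ℝ)|⁻¹) :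
    ((fun n => coshI (z n) - coshI (leadExp γ n)) =O[cofinite] fun n : ℤ => |(n : ℝ)|⁻¹) ∧
      ((fun n => sinhI (z n) - sinhI (leadExp γ n)) =O[cofinite] fun n : ℤ => |(n : ℝ)|⁻¹) := by
  have h1 : ∀ᶠ n in cofinite, ‖z n - leadExp γ n‖ ≤ 1 :=
    (tendsto_zero_iff_norm_tendsto_zero.1
      (hz.trans_tendsto tendsto_inv_abs_int)).eventually_le_const one_pos
  -- The real part of `leadExp γ n` does not depend on `n`, so one Lipschitz constant serves all
  -- indices.
  have h2 : ∀ n, |(leadExp γ n).re| ≤ abs (1 / 2 * Real.log |(γ - 1) / (γ + 1)|) := fun n => by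
    rw [leadExp_eq]; simp
  constructor
  · refine IsBigO.trans (IsBigO.of_bound (2 * Real.exp (abs (1 / 2 * Real.log |(γ - 1) / (γ + 1)|)))
      ?_) hz
    filter_upwards [h1] with n hn
    exact (norm_coshI_sub_le (h2 n) hn).1
  · refine IsBigO.trans (IsBigO.of_bound (2 * Real.exp (abs (1 / 2 * Real.log |(γ - 1) / (γ + 1)|)))
      ?_) hz
    filter_upwards [h1] with n hn
    exact (norm_coshI_sub_le (h2 n) hn).2

lemma norm_toL2_le (φ : C(I, ℂ)) : ‖toL2 φ‖ ≤ ‖φ‖ := by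
  have := Lp.norm_le_of_ae_bound (f := toL2 φ) (norm_nonneg φ) (by
    filter_upwards [coeFn_toL2 φ] with x hx
    rw [hx]; exact φ.norm_coe_le_norm x)
  have h1 : measureUnivNNReal (volume : Measure I) = 1 := by simp [measureUnivNNReal]
  simpa [h1] using this

/-- Deviations of order `1/|n|` are square-summable; this is the hypothesis of the Riesz basis
perturbation. -/
lemma summable_norm_sq_expState_sub {z : ℤ → ℂ}
    (hz : (fun n => z n - leadExp γ n) =O[cofinite] fun n : ℤ => |(n : ℝ)|⁻¹) :
    Summable fun n => ‖expState (z n) - expState (leadExp γ n)‖ ^ 2 := by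
  obtain ⟨hc, hs⟩ := isBigO_coshI_sub_leadExp hz
  have hle : ∀ n, ‖expState (z n) - expState (leadExp γ n)‖ ^ 2 ≤
      ‖coshI (z n) - coshI (leadExp γ n)‖ ^ 2 + ‖sinhI (z n) - sinhI (leadExp γ n)‖ ^ 2 := by
    intro n
    rw [StateSpace.norm_sq_eq]
    have e1 : (expState (z n) - expState (leadExp γ n)).fst.deriv =
        toL2 (coshI (z n) - coshI (leadExp γ n)) := by
      rw [map_sub, ← expState_deriv, ← expState_deriv, ← map_sub]; rfl
    have e2 : (expState (z n) - expState (leadExp γ n)).snd =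
        toL2 (sinhI (z n) - sinhI (leadExp γ n)) := by
      rw [map_sub, ← expState_snd, ← expState_snd]; rfl
    rw [e1, e2]
    gcongr <;> exact norm_toL2_le _
  have hsum : Summable fun n : ℤ => (|(n : ℝ)|⁻¹) ^ 2 := by
    have := Real.summable_one_div_int_pow (p := 2)
    simpa using this
  refine Summable.of_nonneg_of_le (fun n => by positivity) hle ?_
  exact (summable_of_isBigO hsum (hc.norm_left.pow 2)).add
    (summable_of_isBigO hsum (hs.norm_left.pow 2))

lemma leadPlus_eq (hγ : 0 < γ) (hγ1 : γ ≠ 1) (n : ℤ) (x : ℝ) :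
    leadPlus γ n x = Complex.exp (leadExp γ n * (x - 1)) := by
  have hr : (γ - 1) / (γ + 1) ≠ 0 := div_ne_zero (sub_ne_zero.2 hγ1) (by positivity)
  rw [leadPlus, Real.rpow_def_of_pos (abs_pos.2 hr), Complex.ofReal_exp, ← Complex.exp_add, leadExp]
  congr 1
  push_cast
  ring

lemma leadMinus_eq (hγ : 0 < γ) (hγ1 : γ ≠ 1) (n : ℤ) (x : ℝ) :
    leadMinus γ n x = Complex.exp (-(leadExp γ n * (x - 1))) := by
  have hr : (γ + 1) / (γ - 1) ≠ 0 := div_ne_zero (by positivity) (sub_ne_zero.2 hγ1)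
  have e : |(γ + 1) / (γ - 1)| = |(γ - 1) / (γ + 1)|⁻¹ := by rw [← abs_inv, inv_div]
  rw [leadMinus, Real.rpow_def_of_pos (abs_pos.2 hr), Complex.ofReal_exp, ← Complex.exp_add, leadExp,
    e, Real.log_inv]
  congr 1
  push_cast
  ring

/-- Finitely many exceptional indices only enlarge the constant, except `n = 0`, where the
comparison function vanishes by convention; the value there is replaced by `0`. -/
lemma exists_bound_of_isBigO_inv_abs_int {E : Type*} [NormedAddCommGroup E] {f : ℤ → E}
    (hf : f =O[cofinite] fun n : ℤ => |(n : ℝ)|⁻¹) :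
    ∃ C : ℝ, ∀ n : ℤ, n ≠ 0 → ‖f n‖ ≤ C / |(n : ℝ)| := by
  have h1 : (fun n : ℤ => if n = 0 then 0 else f n) =O[cofinite] fun n : ℤ => |(n : ℝ)|⁻¹ := by
    refine hf.congr' ?_ EventuallyEq.rfl
    filter_upwards [(finite_singleton (0 : ℤ)).compl_mem_cofinite] with n hn
    exact (if_neg hn).symm
  rw [isBigO_cofinite_iff (fun n hn => by simpa using fun h : n ≠ 0 => absurd hn (by simpa using h))]
    at h1
  obtain ⟨C, hC⟩ := h1
  refine ⟨C, fun n hn => ?_⟩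
  have := hC n
  rwa [if_neg hn, norm_inv, Real.norm_eq_abs, abs_abs, ← div_eq_mul_inv] at this

lemma exists_uniform_bound (hγ : 0 < γ) (hγ1 : γ ≠ 1) {z : ℤ → ℂ} (hz0 : ∀ n, z n ≠ 0)
    (hz : (fun n => z n - leadExp γ n) =O[cofinite] fun n : ℤ => |(n : ℝ)|⁻¹) :
    ∃ C : ℝ, ∀ n : ℤ, n ≠ 0 → ∀ x ∈ Icc (0 : ℝ) 1,
      ‖(z n)⁻¹ * deriv (sinhFn (z n)) x - (leadPlus γ n x + leadMinus γ n x) / 2‖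
          ≤ C / |(n : ℝ)| ∧
      ‖sinhFn (z n) x - (leadPlus γ n x - leadMinus γ n x) / 2‖ ≤ C / |(n : ℝ)| := by
  obtain ⟨hc, hs⟩ := isBigO_coshI_sub_leadExp hz
  obtain ⟨C₁, hC₁⟩ := exists_bound_of_isBigO_inv_abs_int hc
  obtain ⟨C₂, hC₂⟩ := exists_bound_of_isBigO_inv_abs_int hs
  refine ⟨max C₁ C₂, fun n hn x hx => ⟨?_, ?_⟩⟩
  · have e : (z n)⁻¹ * deriv (sinhFn (z n)) x - (leadPlus γ n x + leadMinus γ n x) / 2 =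
        (coshI (z n) - coshI (leadExp γ n)) ⟨x, hx⟩ := by
      have hd : deriv (sinhFn (z n)) x = z n * Complex.cosh (z n * (x - 1)) :=
        (hasDerivAt_sinh_mul_sub_one (z n) x).deriv
      rw [hd, inv_mul_cancel_left₀ (hz0 n), leadPlus_eq hγ hγ1, leadMinus_eq hγ hγ1,
        ContinuousMap.sub_apply, coshI_apply, coshI_apply,
        Complex.cosh, Complex.cosh]
    rw [e]
    refine (ContinuousMap.norm_coe_le_norm _ _).trans ((hC₁ n hn).trans ?_)
    gcongr
    exact le_max_left _ _
  · have e : sinhFn (z n) x - (leadPlus γ n x - leadMinus γ n x) / 2 =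
        (sinhI (z n) - sinhI (leadExp γ n)) ⟨x, hx⟩ := by
      rw [leadPlus_eq hγ hγ1, leadMinus_eq hγ hγ1,
        ContinuousMap.sub_apply, sinhI_apply, sinhI_apply]
      rfl
    rw [e]
    refine (ContinuousMap.norm_coe_le_norm _ _).trans ((hC₂ n hn).trans ?_)
    gcongr
    exact le_max_right _ _

end Asymptotics

/-! ### Assembly of the spectral statement for the wave operator. -/

theorem lemma4 (γ β : ℝ) (hγ : 0 < γ) (hβ : 0 < β) (hγ1 : γ ≠ 1) :
    -- the operator is discrete
    IsDiscreteOperator (waveOperator γ β) ∧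
    ∃ (lam : ℤ → ℂ) (E Φ : ℤ → StateSpace),
      -- the `lam n` are the eigenvalues, all of them, and none vanishes
      (∀ z : ℂ, IsEigenvalue (waveOperator γ β) z ↔ ∃ n, lam n = z) ∧
      (∀ n, lam n ≠ 0) ∧
      -- asymptotics of the eigenvalues
      (fun n : ℤ => lam n - (((1 / 2 * Real.log |(γ - 1) / (γ + 1)| : ℝ) : ℂ) +
          nShift γ n * Real.pi * Complex.I)) =O[cofinite] (fun n : ℤ => |(n : ℝ)|⁻¹) ∧
      -- `E n = (lam n⁻¹ f_n, f_n)` with `f_n x = sinh (lam n (x - 1))` is the corresponding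
      -- eigenfunction, unique up to scalar multiples
      (∀ n, (∀ x : I, (E n).fst.fn x = (lam n)⁻¹ * sinhFn (lam n) x) ∧
        (∀ᵐ x : I, (E n).snd x = sinhFn (lam n) x) ∧
        IsEigenvector (waveOperator γ β) (lam n) (E n) ∧
        ∀ X, IsEigenvector (waveOperator γ β) (lam n) X → ∃ c : ℂ, X = c • E n) ∧
      -- asymptotics of `F_n = (lam n⁻¹ f_n', f_n)`, uniformly on `[0,1]`
      (∃ C : ℝ, ∀ n : ℤ, n ≠ 0 → ∀ x ∈ Icc (0 : ℝ) 1,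
        ‖(lam n)⁻¹ * deriv (sinhFn (lam n)) x - (leadPlus γ n x + leadMinus γ n x) / 2‖
            ≤ C / |(n : ℝ)| ∧
        ‖sinhFn (lam n) x - (leadPlus γ n x - leadMinus γ n x) / 2‖ ≤ C / |(n : ℝ)|) ∧
      -- generalized eigenfunctions for these eigenvalues form a Riesz basis
      (∀ n, IsGeneralizedEigenvector (waveOperator γ β) (lam n) (Φ n)) ∧
      IsRieszBasis Φ := by
  refine ⟨isDiscreteOperator_waveOperator hβ, ?_⟩
  have hA := mem_waveOperator_graph_iff (γ := γ) hβ
  obtain ⟨z, hzO, hzroot, hzlim⟩ := exists_isCharRoot hγ hγ1 hβ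
  have hzev : ∀ n, z n ≠ 0 ∧ IsCharRoot γ β (z n) →
      waveInv γ β (expState (z n)) = (z n)⁻¹ • expState (z n) := fun n ⟨h0, hr⟩ => by
    have := (mem_waveGraph_iff hβ _ _).1 (expState_mem_waveGraph h0 hr)
    rw [map_smul] at this
    rw [eq_inv_smul_iff₀ h0]
    exact this.symm
  set J₀ : Finset ℤ := (eventually_cofinite.1 hzroot).toFinset with hJ₀
  have hJ₀' : ∀ n ∉ J₀, z n ≠ 0 ∧ IsCharRoot γ β (z n) := fun n hn => by
    simpa [hJ₀] using hn
  obtain ⟨J, ν, Φ, h1, h2, h3, h4, h5⟩ :=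
    (fourierState γ).exists_riesz_basis_of_root_vectors (denseRange_waveInv hγ hγ1 hβ)
      (leadEquiv γ) (F := fun n => expState (z n)) (μ := fun n => (z n)⁻¹) (J₀ := J₀)
      (by simpa only [leadEquiv_fourierState] using summable_norm_sq_expState_sub hzO)
      (fun n hn => hzev n (hJ₀' n hn)) hzlim (fun n hn => inv_ne_zero (hJ₀' n hn).1)
  have hlam0 : ∀ n, (ν n)⁻¹ ≠ 0 := fun n => inv_ne_zero (h2 n)
  have hΦ0 : ∀ n, Φ n ≠ 0 := fun n h => by
    obtain ⟨b, T, hT⟩ := h4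
    have : b n = 0 := by simpa [h] using hT n
    exact b.orthonormal.ne_zero n this
  have hlamO : (fun n => (ν n)⁻¹ - leadExp γ n) =O[cofinite] fun n : ℤ => |(n : ℝ)|⁻¹ := by
    refine hzO.congr' ?_ EventuallyEq.rfl
    filter_upwards [J.finite_toSet.compl_mem_cofinite] with n hn
    rw [h1 n hn, inv_inv]
  have hev : ∀ n, IsEigenvalue (waveOperator γ β) (ν n)⁻¹ := fun n => by
    obtain ⟨k, hk⟩ := h3 n
    exact isEigenvalue_of_pow_sub_smul_apply_eq_zero hA (h2 n) k (hΦ0 n) hk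
  have huniq : ∀ n X, IsEigenvector (waveOperator γ β) (ν n)⁻¹ X →
      ∃ c : ℂ, X = c • expState (ν n)⁻¹ := fun n X hX => by
    refine eq_smul_expState_of_mem_waveGraph (γ := γ) (β := β) ((mem_waveGraph_iff hβ _ _).2 ?_)
    rw [map_smul]
    exact ((isEigenvector_iff_of_graph_eq_inverse hA).1 hX).2
  refine ⟨fun n => (ν n)⁻¹, fun n => expState (ν n)⁻¹, Φ, fun w => ⟨fun ⟨X, hX⟩ => ?_, ?_⟩, hlam0,
    hlamO, fun n => ⟨expState_fn (hlam0 n), ?_, ?_, huniq n⟩,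
    exists_uniform_bound hγ hγ1 hlam0 hlamO, fun n => ⟨hΦ0 n, ?_⟩, h4⟩
  · obtain ⟨hX0, hX⟩ := (isEigenvector_iff_of_graph_eq_inverse hA).1 hX
    have hw : w ≠ 0 := by
      rintro rfl
      exact hX0 (by simpa using hX)
    obtain ⟨n, hn⟩ := h5 w⁻¹ X hX0 ((eq_inv_smul_iff₀ hw).2 hX.symm)
    exact ⟨n, (congrArg _ hn).trans (inv_inv w)⟩
  · rintro ⟨n, rfl⟩
    exact hev n
  · filter_upwards [coeFn_toL2 (sinhI (ν n)⁻¹)] with x hx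
    rw [expState_snd, hx]
    rfl
  -- For indices in `J` the eigenvalue comes from linear algebra, with no characteristic equation at
  -- hand. Some eigenvector exists, uniqueness makes it a nonzero multiple of the exponential state,
  -- and so the latter is an eigenvector.
  · obtain ⟨X, hX⟩ := hev n
    obtain ⟨c, hc⟩ := huniq n X hX
    rw [isEigenvector_iff_of_graph_eq_inverse hA] at hX ⊢
    refine ⟨expState_ne_zero _, ?_⟩
    have hc0 : c ≠ 0 := by
      rintro rfl
      exact hX.1 (by rw [hc, zero_smul])
    have := hX.2
    rw [hc, map_smul, smul_comm] at this
    exact smul_right_injective _ hc0 this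
  · obtain ⟨k, hk⟩ := h3 n
    exact ⟨k, powKills_of_pow_sub_smul_apply_eq_zero hA (waveInv_injective hβ) (h2 n) k hk⟩
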